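/- **Corollary 3 (two copies).** Let $c=(18\pi^3)^{-1}$. For $n\ge 0$ let $|\psi\rangle$ be a Haar-random pure state of $n$ qubits (a uniformly distributed unit vector of $(\mathbb{C}^2)^{\otimes n}$), and write $\psi^{\otimes 2}=(|\psi\rangle\langle\psi|)^{\otimes 2}$, a state of $2n$ qubits. For a set $\Lambda$ of these $2n$ qubits put $\mathcal{I}_\Lambda(\psi^{\otimes 2})=\big\|\operatorname{Tr}_{\bar\Lambda}[\psi^{\otimes 2}]-\mathbb{1}_\Lambda/2^{|\Lambda|}\big\|_1$. Let $D,s:\mathbb{N}\to\mathbb{N}$ satisfy $D(n)\in\mathcal{O}(\log n)$ and $s(n)\in\mathcal{O}(\log n)$. Then there is a constant $K$, depending only on $D$ and $s$, such that the following holds for every $n$. Let $U(\vec\theta)$ be a one-dimensional alternating layered hardware efficient ansatz (HEA) of depth $D(n)$ on the $2n$ qubits (the qubits of the first copy followed by those of the second): it consists of $D(n)$ layers, alternating in a brick-like fashion, of two-qubit gates on neighbouring qubits, each gate being a product of factors $e^{-i\theta_l H_l}V_l$ with a fixed unitary $V_l$ and a traceless Pauli operator $H_l$ on its two qubits. Let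 $O=\sum_i c_iP_i$ be a Hermitian operator on the $2n$ qubits, expanded in Pauli operators, such that $|\operatorname{supp}(P_i)|\le s(n)$ whenever $c_i\ne 0$. Put $f(\vec\theta)=\operatorname{Tr}[U(\vec\theta)\,\psi^{\otimes 2}\,U(\vec\theta)^\dagger O]$ and $f_{trv}=2^{-2n}\operatorname{Tr}[O]$. Then, with probability at least $$1-\exp\!\big(-c\,2^{n/3-4}+(2n+1)\ln 2\big)$$ over the choice of $|\psi\rangle$, one has simultaneously $$\mathcal{I}_\Lambda(\psi^{\otimes 2})\le 2^{|\Lambda|-n/3}\quad\text{for every set }\Lambda\text{ of the }2n\text{ qubits},$$ $$|f(\vec\theta)-f_{trv}|\le K\,\|O\|_\infty\,2^{-n/6}\quad\text{for all }\vec\theta ,$$ where $\|O\|_\infty$ is the operator norm. In particular, $|f(\vec\theta)-f_{trv}|\in\mathcal{O}(2^{-n/6})$ when $\|O\|_\infty\in\mathcal{O}(1)$. -/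

import Mathlib

open MeasureTheory Matrix Filter Asymptotics

noncomputable section

/-- Operators on a register of qubits labelled by `ι`, as matrices in the computational basis,
whose vectors are labelled by the bit strings `ι → Fin 2`. -/
abbrev QOp (ι : Type) : Type := Matrix (ι → Fin 2) (ι → Fin 2) ℂ

/-- The labels of the single-qubit Pauli matrices (`I` is the identity). -/
inductive Pauli : Type
  | I | X | Y | Z
  deriving DecidableEq

/-- The single-qubit Pauli matrices. -/
def Pauli.mat : Pauli → Matrix (Fin 2) (Fin 2) ℂ
  | .I => !![1, 0; 0, 1]
  | .X => !![0, 1; 1, 0]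
  | .Y => !![0, -Complex.I; Complex.I, 0]
  | .Z => !![1, 0; 0, -1]

/-- The Pauli operator `⨂ q, P q`. -/
def pauliOp {ι : Type} [Fintype ι] (P : ι → Pauli) : QOp ι :=
  fun x y => ∏ q, (P q).mat (x q) (y q)

/-- The support of a Pauli operator: the qubits on which it is not the identity. -/
def pauliSupp {ι : Type} [Fintype ι] (P : ι → Pauli) : Finset ι :=
  Finset.univ.filter fun q => P q ≠ Pauli.I

/-- The coefficient `Tr[O P] / 2 ^ N` of an `N`-qubit operator `O` in the Pauli basis. -/
def pauliCoeff {N : ℕ} (O : QOp (Fin N)) (P : Fin N → Pauli) : ℂ :=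
  Matrix.trace (O * pauliOp P) / 2 ^ N

/-- The operator on all the qubits that acts as `A` on the qubits of `S` and as the identity on
the others. -/
def actOn {N : ℕ} (S : Finset (Fin N)) (A : QOp S) : QOp (Fin N) :=
  fun x y => if ∀ q, q ∉ S → x q = y q then A (fun q => x q) (fun q => y q) else 0

/-- The bit string on all the qubits that is `x` on `S` and `z` off `S`. -/
def glue {N : ℕ} (S : Finset (Fin N)) (x : S → Fin 2) (z : {q : Fin N // q ∉ S} → Fin 2) :
    Fin N → Fin 2 :=
  fun q => if h : q ∈ S then x ⟨q, h⟩ else z ⟨q, h⟩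

/-- The reduced operator on the qubits of `S`: the partial trace over all the other qubits. -/
def reduced {N : ℕ} (S : Finset (Fin N)) (ρ : QOp (Fin N)) : QOp S :=
  fun x y => ∑ z : {q : Fin N // q ∉ S} → Fin 2, ρ (glue S x z) (glue S y z)

/-- The trace norm `Tr √(Aᴴ A)`, the sum of the singular values of `A`. -/
def traceNorm {m : Type} [Fintype m] [DecidableEq m] (A : Matrix m m ℂ) : ℝ :=
  ∑ i, Real.sqrt ((Matrix.isHermitian_conjTranspose_mul_self A).eigenvalues i)

/-- The operator norm `‖A‖_∞` on the Hilbert space `ℂ ^ m`. -/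
def opNorm {m : Type} [Fintype m] [DecidableEq m] (A : Matrix m m ℂ) : ℝ :=
  ‖Matrix.toEuclideanCLM (n := m) (𝕜 := ℂ) A‖

/-- The information measure `𝓘_Λ(ρ) = ‖ρ_Λ - 1 / 2 ^ |Λ|‖₁`. -/
def infoMeasure {N : ℕ} (Λ : Finset (Fin N)) (ρ : QOp (Fin N)) : ℝ :=
  traceNorm (reduced Λ ρ - ((2 : ℂ) ^ Λ.card)⁻¹ • (1 : QOp Λ))

/-- The Hilbert space of `n` qubits. -/
abbrev QSpace (n : ℕ) : Type := EuclideanSpace ℂ (Fin n → Fin 2)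

/-- The pure states of `n` qubits, as unit vectors. -/
abbrev QState (n : ℕ) : Type := Metric.sphere (0 : QSpace n) 1

/-- The Haar (uniform) probability measure on the pure states of `n` qubits: the surface measure
of the unit sphere, normalized. -/
def haarState (n : ℕ) : Measure (QState n) :=
  ((volume : Measure (QSpace n)).toSphere Set.univ)⁻¹ •
    (volume : Measure (QSpace n)).toSphere

/-- The vector `ψ ⊗ ψ` on `2 n` qubits; the qubits of the first copy come first. -/
def twoCopyVec {n : ℕ} (ψ : QState n) : (Fin (n + n) → Fin 2) → ℂ :=
  fun x => ψ.1 (fun q => x (Fin.castAdd n q)) * ψ.1 (fun q => x (Fin.natAdd n q))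

/-- The density matrix of `ψ ⊗ ψ`. -/
def twoCopies {n : ℕ} (ψ : QState n) : QOp (Fin (n + n)) :=
  Matrix.vecMulVec (twoCopyVec ψ) (star (twoCopyVec ψ))

/-- The `b`-th pair of neighbouring qubits of the chain. -/
def bond {N : ℕ} (b : Fin (N - 1)) : Finset (Fin N) :=
  {⟨b, by omega⟩, ⟨b + 1, by omega⟩}

/-- A one-dimensional alternating layered hardware efficient ansatz with `D` layers on a chain of
`N` qubits: in the layer `t`, a parametrized two-qubit gate `∏ j, exp (- i θ_j H_j) V_j` acts on
every neighbouring pair of qubits whose position `b` has the parity of `t`. Here the `V_j` are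
fixed unitaries and the `H_j` are traceless Pauli operators. (The data at the pairs of the other
parity is not used.) -/
structure HEA (N D : ℕ) : Type where
  /-- the number of factors of a gate -/
  len : Fin D → Fin (N - 1) → ℕ
  /-- the unparametrized unitaries -/
  V : ∀ (t : Fin D) (b : Fin (N - 1)), Fin (len t b) →
    Matrix.unitaryGroup (bond b → Fin 2) ℂ
  /-- the Pauli generators -/
  H : ∀ (t : Fin D) (b : Fin (N - 1)), Fin (len t b) → bond b → Pauli
  H_traceless : ∀ t b j, H t b j ≠ fun _ => Pauli.I

namespace HEA

variable {N D : ℕ}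

/-- The parameter vectors: one angle for every factor of every gate. -/
abbrev Param (U : HEA N D) : Type := ∀ (t : Fin D) (b : Fin (N - 1)), Fin (U.len t b) → ℝ

/-- The two-qubit gate at the pair `b` in the layer `t`. -/
def gate (U : HEA N D) (θ : U.Param) (t : Fin D) (b : Fin (N - 1)) : QOp (bond b) :=
  (List.ofFn fun j : Fin (U.len t b) =>
    NormedSpace.exp ((-Complex.I * (θ t b j : ℂ)) • pauliOp (U.H t b j)) *
      (U.V t b j : QOp (bond b))).prod

/-- The unitary of one layer: the product of its gates, which act on disjoint pairs. -/
def layer (U : HEA N D) (θ : U.Param) (t : Fin D) : QOp (Fin N) :=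
  (List.ofFn fun b : Fin (N - 1) =>
    if (b : ℕ) % 2 = (t : ℕ) % 2 then actOn (bond b) (U.gate θ t b) else 1).prod

/-- The unitary `U(θ)` of the whole circuit; the layer `0` acts first. -/
def unitary (U : HEA N D) (θ : U.Param) : QOp (Fin N) :=
  (List.ofFn fun t : Fin D => U.layer θ t).reverse.prod

/-- The function `f(θ) = Tr[U(θ) ρ U(θ)ᴴ O]`. -/
def cost (U : HEA N D) (ρ O : QOp (Fin N)) (θ : U.Param) : ℂ :=
  Matrix.trace (U.unitary θ * ρ * (U.unitary θ)ᴴ * O)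

end HEA

/-- The trivial value `f_trv = Tr[O] / 2 ^ N` of the cost function of an `N`-qubit observable. -/
def trivialValue {N : ℕ} (O : QOp (Fin N)) : ℂ := Matrix.trace O / 2 ^ N

end

/-! Everything rests on one random event: every nontrivial Pauli expectation `⟨ψ|P|ψ⟩` of a single
copy has modulus at most `ε = 2^(-n/3)`. On it both conclusions hold deterministically.

The event is likely by an elementary volume argument (`measure_cone_le`). A nontrivial `P` is an
involution anticommuting with another Pauli operator, so it is conjugate to `-P`, and `1 - b P` has
determinant `(1 - b²)^(d/2)` up to sign in real dimension `d`. The map shrinks vectors with `⟨x|P|x⟩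
> ε ‖x‖²` by more than this determinant accounts for, so the cone they form is exponentially small
in the ball. A union bound over the `4^n` Pauli operators and both signs finishes; the constant `c`
of the theorem leaves ample room.

Pauli expectations of two copies are products of those of one copy, hence also at most `ε`. Parseval
for the Pauli basis and Cauchy–Schwarz on singular values then bound `infoMeasure`
(`infoMeasure_le`).

For the cost, pass to the Heisenberg picture: by the light cone, the evolved observable contains
only Pauli operators of weight at most `s(2D+1)` (`HEA.conj_unitary_mem_supportedOn`). There are
`exp(O(log³ n)) = 2^(o(n))` of them, so Cauchy–Schwarz over them (`norm_trace_mul_sub_le`) costs at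
most `K 2^(n/6)`, and `2^(-n/3 + n/6) = 2^(-n/6)` remains. -/

/-! ### Concentration of quadratic forms of involutions -/

section Concentration

open scoped Pointwise

variable {E : Type*} [NormedAddCommGroup E] [NormedSpace ℝ E] [FiniteDimensional ℝ E]

/-- The determinant of `1 - b Q` for an involution `Q` that is conjugate to `-Q`. -/
theorem sq_det_id_sub_smul (Q R : E →ₗ[ℝ] E) (hQ : Q * Q = 1) (hR : R * R = 1)
    (hRQ : R * Q = -(Q * R)) (b : ℝ) :
    LinearMap.det (1 - b • Q) ^ 2 = (1 - b ^ 2) ^ Module.finrank ℝ E := by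
  -- Conjugation by `R` flips the sign of `Q`, so both factors of `(1 - bQ)(1 + bQ) = 1 - b²` have
  -- the same determinant.
  have h1 : R * (1 - b • Q) * R = 1 + b • Q := by
    rw [mul_sub, sub_mul, mul_one, hR, mul_smul_comm, hRQ, smul_neg, neg_mul, sub_neg_eq_add,
      smul_mul_assoc, mul_assoc, hR, mul_one]
  have h2 : LinearMap.det R * LinearMap.det R = 1 := by rw [← map_mul, hR, map_one]
  have h3 : LinearMap.det (1 + b • Q) = LinearMap.det (1 - b • Q) := by
    rw [← h1, map_mul, map_mul]
    linear_combination LinearMap.det (1 - b • Q) * h2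
  have h4 : (1 - b • Q) * (1 + b • Q) = (1 - b ^ 2) • (1 : E →ₗ[ℝ] E) := by
    rw [sub_mul, mul_add, mul_add, one_mul, one_mul, mul_one, smul_mul_smul_comm, hQ,
      sub_smul, one_smul, pow_two]
    abel
  calc LinearMap.det (1 - b • Q) ^ 2
      = LinearMap.det ((1 - b • Q) * (1 + b • Q)) := by rw [map_mul, h3, pow_two]
    _ = _ := by rw [h4, LinearMap.det_smul, map_one, mul_one]

variable [MeasurableSpace E] [BorelSpace E]

/-- A measure concentration estimate: in the unit ball, the cone on which the quadratic form `q`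
of the involution `Q` exceeds `ε ‖x‖ ^ 2` has exponentially small volume. -/
theorem measure_cone_le (μ : Measure E) [μ.IsAddHaarMeasure] (Q R : E →ₗ[ℝ] E)
    (hQ : Q * Q = 1) (hR : R * R = 1) (hRQ : R * Q = -(Q * R)) (q : E → ℝ)
    (hq : ∀ (b : ℝ) (x : E), ‖x - b • Q x‖ ^ 2 = (1 + b ^ 2) * ‖x‖ ^ 2 - 2 * b * q x)
    {ε : ℝ} (hε0 : 0 < ε) (hε1 : ε ≤ 1) :
    μ {x ∈ Metric.ball (0 : E) 1 | ε * ‖x‖ ^ 2 < q x} ≤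
      ENNReal.ofReal (Real.exp (-(ε ^ 2 * Module.finrank ℝ E / 4))) *
        μ (Metric.ball (0 : E) 1) := by
  set d := Module.finrank ℝ E
  set S := {x ∈ Metric.ball (0 : E) 1 | ε * ‖x‖ ^ 2 < q x}
  -- To leading order in `ε`, this minimizes the volume ratio, whose square is `((1 + b² - 2bε) / (1
  -- - b²))^d`.
  set b := ε / 2 with hb
  set B : E →ₗ[ℝ] E := 1 - b • Q with hB
  set r := Real.sqrt (1 + b ^ 2 - 2 * b * ε) with hr
  have hrad : 0 < 1 + b ^ 2 - 2 * b * ε := by rw [hb]; nlinarith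
  have hr0 : 0 < r := Real.sqrt_pos.2 hrad
  have hr2 : r ^ 2 = 1 - 3 * ε ^ 2 / 4 := by
    rw [hr, Real.sq_sqrt hrad.le, hb]; ring
  have hb2 : 0 < 1 - b ^ 2 := by rw [hb]; nlinarith
  have hsub : B '' S ⊆ Metric.ball 0 r := by
    rintro _ ⟨x, ⟨hx, hxq⟩, rfl⟩
    have hx1 : ‖x‖ < 1 := by simpa using hx
    have h1 : ‖B x‖ ^ 2 ≤ (r * ‖x‖) ^ 2 := by
      have : B x = x - b • Q x := rfl
      rw [this, hq, mul_pow, hr, Real.sq_sqrt hrad.le]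
      have : 0 < b := by rw [hb]; positivity
      nlinarith
    have h2 : ‖B x‖ ≤ r * ‖x‖ := le_of_sq_le_sq h1 (by positivity)
    rw [mem_ball_zero_iff]
    exact h2.trans_lt (mul_lt_of_lt_one_right hr0 hx1)
  have hvol := measure_mono (μ := μ) hsub
  rw [Measure.addHaar_image_linearMap, Measure.addHaar_ball_of_pos μ 0 hr0] at hvol
  have hdet : |LinearMap.det B| ^ 2 = (1 - b ^ 2) ^ d := by
    rw [sq_abs]; exact sq_det_id_sub_smul Q R hQ hR hRQ b
  have hdet0 : 0 < |LinearMap.det B| := by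
    refine (abs_nonneg _).lt_of_ne fun h => ?_
    rw [← h, zero_pow two_ne_zero] at hdet
    exact (pow_pos hb2 d).ne hdet
  have key : r ^ d ≤ Real.exp (-(ε ^ 2 * d / 4)) * |LinearMap.det B| := by
    refine le_of_sq_le_sq ?_ (by positivity)
    rw [mul_pow, hdet, ← pow_mul, mul_comm d 2, pow_mul, hr2, ← Real.exp_nat_mul]
    have : ((2 : ℕ) : ℝ) * -(ε ^ 2 * d / 4) = d * (-(ε ^ 2 / 2)) := by push_cast; ring
    rw [this, Real.exp_nat_mul, ← mul_pow]
    refine pow_le_pow_left₀ (by rw [← hr2]; positivity) ?_ d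
    have h1 : 1 - ε ^ 2 / 2 ≤ Real.exp (-(ε ^ 2 / 2)) := by
      have := Real.add_one_le_exp (-(ε ^ 2 / 2)); linarith
    -- With `b² = ε²/4` the right side exceeds the left by exactly `ε⁴/8`.
    calc 1 - 3 * ε ^ 2 / 4 ≤ (1 - ε ^ 2 / 2) * (1 - b ^ 2) := by rw [hb]; nlinarith [sq_nonneg (ε^2)]
      _ ≤ _ := by gcongr
  have hd0 : ENNReal.ofReal |LinearMap.det B| ≠ 0 := by simpa using abs_pos.1 hdet0
  refine (ENNReal.mul_le_mul_iff_right hd0 ENNReal.ofReal_ne_top).1 (hvol.trans ?_)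
  rw [← mul_assoc, ← ENNReal.ofReal_mul (abs_nonneg _), mul_comm |LinearMap.det B|]
  gcongr

/-- The corresponding estimate for the normalized surface measure of the unit sphere. -/
theorem toSphere_normalized_le [Nontrivial E] (μ : Measure E) [μ.IsAddHaarMeasure] (Q R : E →ₗ[ℝ] E)
    (hQ : Q * Q = 1) (hR : R * R = 1) (hRQ : R * Q = -(Q * R)) (q : E → ℝ)
    (hqc : Continuous q) (hqs : ∀ (c : ℝ) (x : E), q (c • x) = c ^ 2 * q x)
    (hq : ∀ (b : ℝ) (x : E), ‖x - b • Q x‖ ^ 2 = (1 + b ^ 2) * ‖x‖ ^ 2 - 2 * b * q x)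
    {ε : ℝ} (hε0 : 0 < ε) (hε1 : ε ≤ 1) :
    ((μ.toSphere Set.univ)⁻¹ • μ.toSphere) {x | ε < q x} ≤
      ENNReal.ofReal (Real.exp (-(ε ^ 2 * Module.finrank ℝ E / 4))) := by
  have hm : MeasurableSet {x : Metric.sphere (0 : E) 1 | ε < q x} :=
    (isOpen_lt continuous_const (hqc.comp continuous_subtype_val)).measurableSet
  have h0 : μ.toSphere Set.univ ≠ 0 :=
    fun h => Measure.toSphere_ne_zero μ (Measure.measure_univ_eq_zero.1 h)
  rw [Measure.smul_apply, smul_eq_mul, mul_comm, ← div_eq_mul_inv]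
  refine ENNReal.div_le_of_le_mul ?_
  -- Surface measure is the dimension times the volume of the cone over the set; the dimension
  -- cancels in the normalization.
  rw [Measure.toSphere_apply' μ hm, Measure.toSphere_apply_univ, mul_left_comm]
  gcongr
  refine (measure_mono ?_).trans (measure_cone_le μ Q R hQ hR hRQ q hq hε0 hε1)
  rintro _ ⟨c, hc, _, ⟨x, hx, rfl⟩, rfl⟩
  have hn : ‖(x : E)‖ = 1 := by simp
  have hcn : ‖c • (x : E)‖ = c := by rw [norm_smul, hn, mul_one, Real.norm_of_nonneg hc.1.le]
  refine ⟨by simpa [hcn] using hc.2, ?_⟩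
  have hc2 : 0 < c ^ 2 := pow_pos hc.1 2
  show ε * ‖c • (x : E)‖ ^ 2 < q (c • (x : E))
  rw [hcn, hqs, mul_comm]
  exact mul_lt_mul_of_pos_left hx hc2

end Concentration

/-! ### Single-qubit Pauli matrices -/

instance Pauli.instFintype : Fintype Pauli := ⟨{.I, .X, .Y, .Z}, fun p => by cases p <;> decide⟩

theorem Pauli.sum_univ {M : Type*} [AddCommMonoid M] (f : Pauli → M) :
    ∑ p, f p = f .I + (f .X + (f .Y + f .Z)) := by
  change ∑ p ∈ ({.I, .X, .Y, .Z} : Finset Pauli), f p = _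
  simp

theorem Pauli.mat_I : Pauli.I.mat = 1 := by
  ext i j; fin_cases i <;> fin_cases j <;> simp [Pauli.mat]

theorem Pauli.conjTranspose_mat (p : Pauli) : p.matᴴ = p.mat := by
  cases p <;> ext i j <;> fin_cases i <;> fin_cases j <;> simp [Pauli.mat]

theorem Pauli.mat_mul_self (p : Pauli) : p.mat * p.mat = 1 := by
  cases p <;> ext i j <;> fin_cases i <;> fin_cases j <;> simp [Pauli.mat, Matrix.mul_apply]

theorem Pauli.trace_mat {p : Pauli} (hp : p ≠ .I) : p.mat.trace = 0 := by
  cases p <;> simp_all [Pauli.mat, Matrix.trace]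

theorem Pauli.exists_anticommute {p : Pauli} (hp : p ≠ .I) :
    ∃ r : Pauli, r.mat * p.mat = -(p.mat * r.mat) := by
  cases p
  · exact absurd rfl hp
  · exact ⟨.Z, by ext i j; fin_cases i <;> fin_cases j <;> simp [Pauli.mat, Matrix.mul_apply]⟩
  · exact ⟨.Z, by ext i j; fin_cases i <;> fin_cases j <;> simp [Pauli.mat, Matrix.mul_apply]⟩
  · exact ⟨.X, by ext i j; fin_cases i <;> fin_cases j <;> simp [Pauli.mat, Matrix.mul_apply]⟩

/-- The product of two Pauli matrices is a multiple of a Pauli matrix, which is the identity if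
both are. -/
theorem Pauli.exists_mul (p r : Pauli) :
    ∃ (c : ℂ) (t : Pauli), p.mat * r.mat = c • t.mat ∧ (p = .I → r = .I → t = .I) := by
  have key : ∀ (c : ℂ) (t : Pauli), p.mat * r.mat = c • t.mat → (p = .I → r = .I → t = .I) →
    ∃ (c : ℂ) (t : Pauli), p.mat * r.mat = c • t.mat ∧ (p = .I → r = .I → t = .I) :=
    fun c t h h' => ⟨c, t, h, h'⟩
  by_cases hp : p = .I
  · exact ⟨1, r, by rw [hp, Pauli.mat_I, one_mul, one_smul], fun _ h => h⟩
  by_cases hr : r = .I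
  · exact ⟨1, p, by rw [hr, Pauli.mat_I, mul_one, one_smul], fun h _ => h⟩
  cases p <;> cases r <;> simp only [not_true_eq_false, reduceCtorEq] at hp hr
  · exact key 1 .I (by rw [Pauli.mat_mul_self, Pauli.mat_I, one_smul]) (by simp)
  · refine key Complex.I .Z ?_ (by simp)
    ext i j; fin_cases i <;> fin_cases j <;> simp [Pauli.mat, Matrix.mul_apply]
  · refine key (-Complex.I) .Y ?_ (by simp)
    ext i j; fin_cases i <;> fin_cases j <;> simp [Pauli.mat, Matrix.mul_apply]
  · refine key (-Complex.I) .Z ?_ (by simp)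
    ext i j; fin_cases i <;> fin_cases j <;> simp [Pauli.mat, Matrix.mul_apply]
  · exact key 1 .I (by rw [Pauli.mat_mul_self, Pauli.mat_I, one_smul]) (by simp)
  · refine key Complex.I .X ?_ (by simp)
    ext i j; fin_cases i <;> fin_cases j <;> simp [Pauli.mat, Matrix.mul_apply]
  · refine key Complex.I .Y ?_ (by simp)
    ext i j; fin_cases i <;> fin_cases j <;> simp [Pauli.mat, Matrix.mul_apply]
  · refine key (-Complex.I) .X ?_ (by simp)
    ext i j; fin_cases i <;> fin_cases j <;> simp [Pauli.mat, Matrix.mul_apply]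
  · exact key 1 .I (by rw [Pauli.mat_mul_self, Pauli.mat_I, one_smul]) (by simp)

/-- The single-qubit completeness relation; its product over the qubits gives `pauli_expansion`. -/
theorem Pauli.sum_mat_mul_mat (u v x y : Fin 2) :
    ∑ p : Pauli, p.mat v u * p.mat x y = if u = x ∧ v = y then 2 else 0 := by
  rw [Pauli.sum_univ]
  fin_cases u <;> fin_cases v <;> fin_cases x <;> fin_cases y <;> simp [Pauli.mat] <;> norm_num

/-! ### Tensor products, Pauli expansion and Parseval -/

/-- The tensor product of single-qubit operators. -/
def tensorOp {ι : Type} [Fintype ι] (M : ι → Matrix (Fin 2) (Fin 2) ℂ) : QOp ι :=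
  fun x y => ∏ q, M q (x q) (y q)

theorem pauliOp_eq_tensorOp {ι : Type} [Fintype ι] (P : ι → Pauli) :
    pauliOp P = tensorOp fun q => (P q).mat := rfl

theorem tensorOp_mul {ι : Type} [Fintype ι] [DecidableEq ι]
    (M M' : ι → Matrix (Fin 2) (Fin 2) ℂ) :
    tensorOp M * tensorOp M' = tensorOp fun q => M q * M' q := by
  ext x z
  simp only [Matrix.mul_apply, tensorOp, ← Finset.prod_mul_distrib]
  rw [Finset.prod_univ_sum, Fintype.piFinset_univ]

theorem tensorOp_one {ι : Type} [Fintype ι] [DecidableEq ι] :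
    tensorOp (fun _ : ι => (1 : Matrix (Fin 2) (Fin 2) ℂ)) = 1 := by
  ext x y
  simp only [tensorOp, Matrix.one_apply]
  by_cases h : x = y
  · simp [h]
  · obtain ⟨q, hq⟩ := Function.ne_iff.1 h
    rw [if_neg h]
    exact Finset.prod_eq_zero (Finset.mem_univ q) (if_neg hq)

theorem conjTranspose_tensorOp {ι : Type} [Fintype ι] (M : ι → Matrix (Fin 2) (Fin 2) ℂ) :
    (tensorOp M)ᴴ = tensorOp fun q => (M q)ᴴ := by
  ext x y
  simp [tensorOp, Matrix.conjTranspose_apply]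

theorem trace_tensorOp {ι : Type} [Fintype ι] [DecidableEq ι]
    (M : ι → Matrix (Fin 2) (Fin 2) ℂ) : (tensorOp M).trace = ∏ q, (M q).trace := by
  simp only [Matrix.trace, Matrix.diag, tensorOp]
  rw [Finset.prod_univ_sum, Fintype.piFinset_univ]

theorem conjTranspose_pauliOp {ι : Type} [Fintype ι] (P : ι → Pauli) : (pauliOp P)ᴴ = pauliOp P := by
  simp_rw [pauliOp_eq_tensorOp, conjTranspose_tensorOp, Pauli.conjTranspose_mat]

theorem tensorOp_smul_mat {ι : Type} [Fintype ι] (c : ι → ℂ) (P : ι → Pauli) :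
    tensorOp (fun q => c q • (P q).mat) = (∏ q, c q) • pauliOp P := by
  ext x y
  simp [tensorOp, pauliOp, Finset.prod_mul_distrib]

section PauliOp

variable {ι : Type} [Fintype ι] [DecidableEq ι]

theorem pauliOp_const_I : pauliOp (fun _ : ι => Pauli.I) = 1 := by
  simp_rw [pauliOp_eq_tensorOp, Pauli.mat_I, tensorOp_one]

theorem pauliOp_mul_self (P : ι → Pauli) : pauliOp P * pauliOp P = 1 := by
  simp_rw [pauliOp_eq_tensorOp, tensorOp_mul, Pauli.mat_mul_self, tensorOp_one]

theorem trace_pauliOp {P : ι → Pauli} (hP : P ≠ fun _ => Pauli.I) : (pauliOp P).trace = 0 := by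
  obtain ⟨q, hq⟩ := Function.ne_iff.1 hP
  rw [pauliOp_eq_tensorOp, trace_tensorOp]
  exact Finset.prod_eq_zero (Finset.mem_univ q) (Pauli.trace_mat hq)

theorem exists_pauliOp_mul (P R : ι → Pauli) :
    ∃ (c : ℂ) (T : ι → Pauli), pauliOp P * pauliOp R = c • pauliOp T ∧
      ∀ q, P q = .I → R q = .I → T q = .I := by
  choose c t h h' using fun q => Pauli.exists_mul (P q) (R q)
  refine ⟨∏ q, c q, t, ?_, h'⟩
  rw [← tensorOp_smul_mat, pauliOp_eq_tensorOp, pauliOp_eq_tensorOp, tensorOp_mul]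
  simp_rw [h]

/-- A nontrivial Pauli operator anticommutes with some Pauli operator. -/
theorem exists_pauliOp_anticommute {P : ι → Pauli} (hP : P ≠ fun _ => Pauli.I) :
    ∃ R : ι → Pauli, pauliOp R * pauliOp P = -(pauliOp P * pauliOp R) := by
  obtain ⟨q, hq⟩ := Function.ne_iff.1 hP
  obtain ⟨r, hr⟩ := Pauli.exists_anticommute hq
  -- A single anticommuting site gives exactly one sign; the other sites commute.
  refine ⟨Function.update (fun _ => .I) q r, ?_⟩
  simp_rw [pauliOp_eq_tensorOp, tensorOp_mul]
  ext x y
  simp only [tensorOp, Matrix.neg_apply]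
  rw [← Finset.mul_prod_erase _ _ (Finset.mem_univ q), ← Finset.mul_prod_erase _ _ (Finset.mem_univ q),
    ← neg_mul]
  congr 1
  · rw [Function.update_self, hr, Matrix.neg_apply]
  · refine Finset.prod_congr rfl fun k hk => ?_
    rw [Function.update_of_ne (Finset.ne_of_mem_erase hk), Pauli.mat_I, one_mul, mul_one]

/-- Pauli operators with disjoint supports commute. -/
theorem pauliOp_commute {P R : ι → Pauli} (h : ∀ q, P q = .I ∨ R q = .I) :
    pauliOp P * pauliOp R = pauliOp R * pauliOp P := by
  simp_rw [pauliOp_eq_tensorOp, tensorOp_mul]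
  congr 1
  funext q
  rcases h q with h | h <;> simp [h, Pauli.mat_I]

/-- The Pauli expansion of an operator. -/
theorem pauli_expansion (A : QOp ι) :
    A = ∑ P : ι → Pauli, ((A * pauliOp P).trace / 2 ^ Fintype.card ι) • pauliOp P := by
  ext x y
  have key : ∀ u v : ι → Fin 2, ∑ P : ι → Pauli, pauliOp P v u * pauliOp P x y =
      if u = x ∧ v = y then 2 ^ Fintype.card ι else 0 := by
    intro u v
    simp only [pauliOp, ← Finset.prod_mul_distrib]
    rw [← Fintype.piFinset_univ, ← Finset.prod_univ_sum (fun _ : ι => (Finset.univ : Finset Pauli))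
      (fun q p => p.mat (v q) (u q) * p.mat (x q) (y q))]
    simp_rw [Pauli.sum_mat_mul_mat]
    by_cases h : u = x ∧ v = y
    · rw [if_pos h]; simp [h.1, h.2]
    · rw [if_neg h]
      have : ∃ q, ¬ (u q = x q ∧ v q = y q) := by
        by_contra! hc
        exact h ⟨funext fun q => (hc q).1, funext fun q => (hc q).2⟩
      obtain ⟨q, hq⟩ := this
      exact Finset.prod_eq_zero (Finset.mem_univ q) (if_neg hq)
  rw [Matrix.sum_apply]
  simp only [Matrix.smul_apply, smul_eq_mul, Matrix.trace, Matrix.diag, Matrix.mul_apply]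
  have h2 : (2 : ℂ) ^ Fintype.card ι ≠ 0 := pow_ne_zero _ two_ne_zero
  calc A x y = (∑ u, ∑ v, A u v * ∑ P : ι → Pauli, pauliOp P v u * pauliOp P x y)
        / 2 ^ Fintype.card ι := by
        rw [eq_div_iff h2]
        simp_rw [key]
        rw [Finset.sum_eq_single x, Finset.sum_eq_single y]
        · simp
        · intro b _ hb; simp [hb]
        · simp
        · intro b _ hb; simp [hb]
        · simp
    _ = _ := by
        simp_rw [Finset.mul_sum, Finset.sum_div, Finset.sum_mul]
        symm
        rw [Finset.sum_comm]
        refine Finset.sum_congr rfl fun u _ => ?_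
        rw [Finset.sum_comm]
        refine Finset.sum_congr rfl fun v _ => Finset.sum_congr rfl fun P _ => ?_
        ring

theorem pauliOp_orthogonal_of_mem {P Q : ι → Pauli} {q : ι} (hP : P q = .I) (hQ : Q q ≠ .I) :
    (pauliOp P * pauliOp Q).trace = 0 := by
  simp_rw [pauliOp_eq_tensorOp, tensorOp_mul, trace_tensorOp]
  refine Finset.prod_eq_zero (Finset.mem_univ q) ?_
  rw [hP, Pauli.mat_I, one_mul, Pauli.trace_mat hQ]

theorem trace_conjTranspose_mul_self {m : Type} [Fintype m] (A : Matrix m m ℂ) :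
    (Aᴴ * A).trace = ((∑ i, ∑ j, ‖A i j‖ ^ 2 : ℝ) : ℂ) := by
  simp only [Matrix.trace, Matrix.diag, Matrix.mul_apply, Matrix.conjTranspose_apply]
  rw [Finset.sum_comm]
  push_cast
  refine Finset.sum_congr rfl fun i _ => Finset.sum_congr rfl fun j _ => ?_
  rw [← Complex.conj_mul']
  rfl

/-- Parseval's identity for the Pauli expansion. -/
theorem pauli_parseval (A : QOp ι) :
    ∑ P : ι → Pauli, ‖(A * pauliOp P).trace‖ ^ 2 = 2 ^ Fintype.card ι * ∑ i, ∑ j, ‖A i j‖ ^ 2 := by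
  have h2 : (2 : ℂ) ^ Fintype.card ι ≠ 0 := pow_ne_zero _ two_ne_zero
  have h := congrArg (fun B => (Aᴴ * B).trace) (pauli_expansion A)
  simp only [Finset.mul_sum, Matrix.trace_sum, Matrix.mul_smul, Matrix.trace_smul] at h
  rw [trace_conjTranspose_mul_self] at h
  have h' : ∀ P : ι → Pauli, (Aᴴ * pauliOp P).trace = star (A * pauliOp P).trace := by
    intro P
    rw [← Matrix.trace_conjTranspose, Matrix.conjTranspose_mul, conjTranspose_pauliOp,
      Matrix.trace_mul_comm]
  simp_rw [h', smul_eq_mul, div_mul_eq_mul_div] at h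
  rw [← Finset.sum_div, eq_div_iff h2] at h
  apply Complex.ofReal_injective
  push_cast at h ⊢
  rw [mul_comm, h]
  refine Finset.sum_congr rfl fun P _ => ?_
  rw [← Complex.mul_conj']
  rfl

end PauliOp

/-! ### Operators supported on a set of qubits -/

section Support

variable {N : ℕ}

/-- The operators supported on the qubits of `S`: the span of the Pauli operators that are the
identity off `S`. -/
def supportedOn (S : Finset (Fin N)) : Submodule ℂ (QOp (Fin N)) :=
  Submodule.span ℂ (pauliOp '' {P | ∀ q, q ∉ S → P q = .I})

theorem pauliOp_mem_supportedOn {S : Finset (Fin N)} {P : Fin N → Pauli}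
    (h : ∀ q, q ∉ S → P q = .I) : pauliOp P ∈ supportedOn S :=
  Submodule.subset_span ⟨P, h, rfl⟩

theorem pauliOp_mem_supportedOn_supp (P : Fin N → Pauli) :
    pauliOp P ∈ supportedOn (pauliSupp P) :=
  pauliOp_mem_supportedOn fun q hq => by simpa [pauliSupp] using hq

theorem supportedOn_mono {S T : Finset (Fin N)} (h : S ⊆ T) : supportedOn S ≤ supportedOn T := by
  refine Submodule.span_le.2 ?_
  rintro _ ⟨P, hP, rfl⟩
  exact pauliOp_mem_supportedOn fun q hq => hP q fun hS => hq (h hS)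

theorem mul_mem_supportedOn {S : Finset (Fin N)} {A B : QOp (Fin N)} (hA : A ∈ supportedOn S)
    (hB : B ∈ supportedOn S) : A * B ∈ supportedOn S := by
  induction hA using Submodule.span_induction with
  | zero => rw [zero_mul]; exact zero_mem _
  | add A A' _ _ h h' => rw [add_mul]; exact add_mem h h'
  | smul c A _ h => rw [smul_mul_assoc]; exact Submodule.smul_mem _ c h
  | mem A hA =>
    obtain ⟨P, hP, rfl⟩ := hA
    induction hB using Submodule.span_induction with
    | zero => rw [mul_zero]; exact zero_mem _
    | add A A' _ _ h h' => rw [mul_add]; exact add_mem h h'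
    | smul c A _ h => rw [mul_smul_comm]; exact Submodule.smul_mem _ c h
    | mem B hB =>
      obtain ⟨R, hR, rfl⟩ := hB
      obtain ⟨c, T, h, hT⟩ := exists_pauliOp_mul P R
      rw [h]
      exact Submodule.smul_mem _ c
        (pauliOp_mem_supportedOn fun q hq => hT q (hP q hq) (hR q hq))

theorem conjTranspose_mem_supportedOn {S : Finset (Fin N)} {A : QOp (Fin N)}
    (hA : A ∈ supportedOn S) : Aᴴ ∈ supportedOn S := by
  induction hA using Submodule.span_induction with
  | zero => rw [Matrix.conjTranspose_zero]; exact zero_mem _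
  | add A A' _ _ h h' => rw [Matrix.conjTranspose_add]; exact add_mem h h'
  | smul c A _ h => rw [Matrix.conjTranspose_smul]; exact Submodule.smul_mem _ _ h
  | mem A hA =>
    obtain ⟨P, hP, rfl⟩ := hA
    rw [conjTranspose_pauliOp]
    exact pauliOp_mem_supportedOn hP

theorem commute_of_mem_supportedOn {S T : Finset (Fin N)} (hST : Disjoint S T)
    {A B : QOp (Fin N)} (hA : A ∈ supportedOn S) (hB : B ∈ supportedOn T) : A * B = B * A := by
  induction hA using Submodule.span_induction with
  | zero => rw [mul_zero, zero_mul]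
  | add A A' _ _ h h' => rw [add_mul, mul_add, h, h']
  | smul c A _ h => rw [smul_mul_assoc, mul_smul_comm, h]
  | mem A hA =>
    obtain ⟨P, hP, rfl⟩ := hA
    induction hB using Submodule.span_induction with
    | zero => rw [mul_zero, zero_mul]
    | add A A' _ _ h h' => rw [add_mul, mul_add, h, h']
    | smul c A _ h => rw [smul_mul_assoc, mul_smul_comm, h]
    | mem B hB =>
      obtain ⟨R, hR, rfl⟩ := hB
      refine pauliOp_commute fun q => ?_
      by_cases hq : q ∈ S
      · exact Or.inr (hR q (Finset.disjoint_left.1 hST hq))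
      · exact Or.inl (hP q hq)

theorem trace_mul_pauliOp_of_mem_supportedOn {S : Finset (Fin N)} {A : QOp (Fin N)}
    (hA : A ∈ supportedOn S) {Q : Fin N → Pauli} (hQ : ¬ pauliSupp Q ⊆ S) :
    (A * pauliOp Q).trace = 0 := by
  obtain ⟨q, hq, hqS⟩ := Finset.not_subset.1 hQ
  induction hA using Submodule.span_induction with
  | zero => rw [zero_mul, Matrix.trace_zero]
  | add A A' _ _ h h' => rw [add_mul, Matrix.trace_add, h, h', add_zero]
  | smul c A _ h => rw [smul_mul_assoc, Matrix.trace_smul, h, smul_zero]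
  | mem A hA =>
    obtain ⟨P, hP, rfl⟩ := hA
    exact pauliOp_orthogonal_of_mem (hP q hqS) (by simpa [pauliSupp] using hq)

theorem actOn_add (S : Finset (Fin N)) (A B : QOp S) : actOn S (A + B) = actOn S A + actOn S B := by
  ext x y
  simp only [actOn, Matrix.add_apply]
  split_ifs <;> simp

theorem actOn_smul (S : Finset (Fin N)) (c : ℂ) (A : QOp S) : actOn S (c • A) = c • actOn S A := by
  ext x y
  simp only [actOn, Matrix.smul_apply]
  split_ifs <;> simp

/-- `actOn` as a linear map. -/
def actOnLinear (S : Finset (Fin N)) : QOp S →ₗ[ℂ] QOp (Fin N) where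
  toFun := actOn S
  map_add' := actOn_add S
  map_smul' := actOn_smul S

/-- The extension by the identity. -/
def extendByOne (S : Finset (Fin N)) (M : S → Matrix (Fin 2) (Fin 2) ℂ) (q : Fin N) :
    Matrix (Fin 2) (Fin 2) ℂ :=
  if h : q ∈ S then M ⟨q, h⟩ else 1

theorem actOn_tensorOp (S : Finset (Fin N)) (M : S → Matrix (Fin 2) (Fin 2) ℂ) :
    actOn S (tensorOp M) = tensorOp (extendByOne S M) := by
  ext x y
  simp only [actOn, tensorOp]
  split_ifs with h
  · rw [← Finset.prod_subset (Finset.subset_univ S)]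
    · rw [← Finset.prod_coe_sort S]
      refine Finset.prod_congr rfl fun q _ => ?_
      simp [extendByOne]
    · intro q _ hq
      rw [h q hq]; simp [extendByOne, hq]
  · push Not at h
    obtain ⟨q, hq, hxy⟩ := h
    refine (Finset.prod_eq_zero (Finset.mem_univ q) ?_).symm
    simp [extendByOne, hq, hxy]

/-- The extension of a Pauli label by the identity. -/
def extendPauli (S : Finset (Fin N)) (P : S → Pauli) (q : Fin N) : Pauli :=
  if h : q ∈ S then P ⟨q, h⟩ else .I

theorem actOn_pauliOp (S : Finset (Fin N)) (P : S → Pauli) :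
    actOn S (pauliOp P) = pauliOp (extendPauli S P) := by
  rw [pauliOp_eq_tensorOp, pauliOp_eq_tensorOp, actOn_tensorOp]
  congr 1
  funext q
  by_cases h : q ∈ S <;> simp [extendByOne, extendPauli, h, Pauli.mat_I]

theorem span_pauliOp_eq_top {ι : Type} [Fintype ι] [DecidableEq ι] :
    Submodule.span ℂ (Set.range (pauliOp : (ι → Pauli) → QOp ι)) = ⊤ := by
  refine eq_top_iff.2 fun A _ => ?_
  rw [pauli_expansion A]
  exact Submodule.sum_mem _ fun P _ =>
    Submodule.smul_mem _ _ (Submodule.subset_span ⟨P, rfl⟩)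

theorem actOn_mem_supportedOn (S : Finset (Fin N)) (A : QOp S) : actOn S A ∈ supportedOn S := by
  rw [pauli_expansion A]
  change actOnLinear S _ ∈ _
  rw [map_sum]
  refine Submodule.sum_mem _ fun P _ => ?_
  rw [map_smul]
  refine Submodule.smul_mem _ _ ?_
  change actOn S (pauliOp P) ∈ _
  rw [actOn_pauliOp]
  exact pauliOp_mem_supportedOn fun q hq => by simp [extendPauli, hq]

/-- Both sides are bilinear, so Pauli operators suffice, and for these the identity holds site by
site. -/
theorem actOn_mul (S : Finset (Fin N)) (A B : QOp S) : actOn S (A * B) = actOn S A * actOn S B := by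
  have hlin : (LinearMap.mul ℂ (QOp S)).compr₂ (actOnLinear S) =
      (LinearMap.mul ℂ (QOp (Fin N))).compl₁₂ (actOnLinear S) (actOnLinear S) := by
    refine LinearMap.ext_on_range span_pauliOp_eq_top fun P => ?_
    refine LinearMap.ext_on_range span_pauliOp_eq_top fun R => ?_
    change actOn S (pauliOp P * pauliOp R) = actOn S (pauliOp P) * actOn S (pauliOp R)
    simp only [pauliOp_eq_tensorOp, tensorOp_mul, actOn_tensorOp]
    congr 1
    funext q
    by_cases h : q ∈ S <;> simp [extendByOne, h]
  exact LinearMap.congr_fun₂ hlin A B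

theorem actOn_one (S : Finset (Fin N)) : actOn S (1 : QOp S) = 1 := by
  rw [← tensorOp_one, actOn_tensorOp, ← tensorOp_one]
  congr 1
  funext q
  simp [extendByOne]

theorem actOn_conjTranspose (S : Finset (Fin N)) (A : QOp S) : actOn S Aᴴ = (actOn S A)ᴴ := by
  ext x y
  simp only [actOn, Matrix.conjTranspose_apply]
  simp_rw [eq_comm (a := y _)]
  split_ifs <;> simp

/-- Duality of partial trace and extension by the identity: Pauli coefficients of a reduced state
are Pauli coefficients of the full state. -/
theorem trace_reduced_mul (S : Finset (Fin N)) (ρ : QOp (Fin N)) (A : QOp S) :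
    (reduced S ρ * A).trace = (ρ * actOn S A).trace := by
  let e := Equiv.piEquivPiSubtypeProd (· ∈ S) (fun _ => Fin 2)
  have he : ∀ w, e.symm w = glue S w.1 w.2 := fun w => rfl
  have h1 : ∀ x z, (fun q : S => glue S x z q) = x := by
    intro x z; funext q; simp [glue]
  have h2 : ∀ x y z w, actOn S A (glue S y w) (glue S x z) = if w = z then A y x else 0 := by
    intro x y z w
    simp only [actOn, h1]
    refine if_congr ?_ rfl rfl
    constructor
    · intro h
      funext q
      have := h q.1 q.2
      simpa [glue, q.2] using this
    · rintro rfl q hq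
      simp [glue, hq]
  simp only [Matrix.trace, Matrix.diag, Matrix.mul_apply]
  rw [← e.symm.sum_comp, Fintype.sum_prod_type]
  refine Finset.sum_congr rfl fun x _ => ?_
  simp_rw [← e.symm.sum_comp (fun Y => ρ _ Y * actOn S A Y _), Fintype.sum_prod_type, he, h2,
    reduced, Finset.sum_mul]
  rw [Finset.sum_comm]
  refine Finset.sum_congr rfl fun z _ => Finset.sum_congr rfl fun y _ => ?_
  simp

end Support

/-! ### Unitarity and the light cone of the circuit -/

section LightCone

theorem exp_pauliOp_mem_unitaryGroup {ι : Type} [Fintype ι] [DecidableEq ι] (P : ι → Pauli)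
    (t : ℝ) : NormedSpace.exp ((-Complex.I * (t : ℂ)) • pauliOp P) ∈
      Matrix.unitaryGroup (ι → Fin 2) ℂ := by
  rw [Matrix.mem_unitaryGroup_iff', Matrix.star_eq_conjTranspose, ← Matrix.exp_conjTranspose,
    Matrix.conjTranspose_smul, conjTranspose_pauliOp]
  have : star (-Complex.I * (t : ℂ)) = -(-Complex.I * (t : ℂ)) := by simp
  rw [this, neg_smul, Matrix.exp_neg]
  exact Matrix.nonsing_inv_mul _ ((Matrix.isUnit_iff_isUnit_det _).1 (Matrix.isUnit_exp _))

variable {N D : ℕ}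

theorem HEA.gate_mem_unitaryGroup (U : HEA N D) (θ : U.Param) (t : Fin D) (b : Fin (N - 1)) :
    U.gate θ t b ∈ Matrix.unitaryGroup (bond b → Fin 2) ℂ := by
  refine Submonoid.list_prod_mem _ fun M hM => ?_
  obtain ⟨j, rfl⟩ := List.mem_ofFn.1 hM
  exact mul_mem (exp_pauliOp_mem_unitaryGroup _ _) (U.V t b j).2

theorem actOn_mem_unitaryGroup {S : Finset (Fin N)} {A : QOp S}
    (hA : A ∈ Matrix.unitaryGroup (S → Fin 2) ℂ) :
    actOn S A ∈ Matrix.unitaryGroup (Fin N → Fin 2) ℂ := by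
  rw [Matrix.mem_unitaryGroup_iff', Matrix.star_eq_conjTranspose] at hA ⊢
  rw [← actOn_conjTranspose, ← actOn_mul, hA, actOn_one]

theorem HEA.layer_mem_unitaryGroup (U : HEA N D) (θ : U.Param) (t : Fin D) :
    U.layer θ t ∈ Matrix.unitaryGroup (Fin N → Fin 2) ℂ := by
  refine Submonoid.list_prod_mem _ fun M hM => ?_
  obtain ⟨b, rfl⟩ := List.mem_ofFn.1 hM
  split_ifs
  · exact actOn_mem_unitaryGroup (U.gate_mem_unitaryGroup θ t b)
  · exact one_mem _

theorem HEA.unitary_mem_unitaryGroup (U : HEA N D) (θ : U.Param) :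
    U.unitary θ ∈ Matrix.unitaryGroup (Fin N → Fin 2) ℂ := by
  refine Submonoid.list_prod_mem _ fun M hM => ?_
  obtain ⟨t, rfl⟩ := List.mem_ofFn.1 (List.mem_reverse.1 hM)
  exact U.layer_mem_unitaryGroup θ t

/-- The qubits at distance at most `t` from `S` on the chain. -/
def thicken (t : ℕ) (S : Finset (Fin N)) : Finset (Fin N) :=
  Finset.univ.filter fun q => ∃ p ∈ S, (q : ℕ) ≤ p + t ∧ (p : ℕ) ≤ q + t

theorem mem_thicken {t : ℕ} {S : Finset (Fin N)} {q : Fin N} :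
    q ∈ thicken t S ↔ ∃ p ∈ S, (q : ℕ) ≤ p + t ∧ (p : ℕ) ≤ q + t := by
  simp [thicken]

theorem card_thicken_le (t : ℕ) (S : Finset (Fin N)) :
    (thicken t S).card ≤ S.card * (2 * t + 1) := by
  have : thicken t S ⊆ S.biUnion fun p =>
      Finset.univ.filter fun q : Fin N => (q : ℕ) ≤ p + t ∧ (p : ℕ) ≤ q + t := by
    intro q hq
    simpa using mem_thicken.1 hq
  refine (Finset.card_le_card this).trans (Finset.card_biUnion_le_card_mul _ _ _ fun p _ => ?_)
  refine (Finset.card_le_card_of_injOn (fun q : Fin N => (q : ℕ))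
    (t := Finset.Icc (p - t) (p + t)) ?_ (Fin.val_injective.injOn)).trans ?_
  · intro q hq
    simp only [Finset.coe_filter, Finset.mem_univ, true_and, Set.mem_ofPred_eq] at hq
    simp only [Finset.coe_Icc, Set.mem_Icc]
    omega
  · rw [Nat.card_Icc]; omega

theorem thicken_one_thicken_subset (t : ℕ) (S : Finset (Fin N)) :
    thicken 1 (thicken t S) ⊆ thicken (t + 1) S := by
  intro q hq
  obtain ⟨p, hp, h1, h2⟩ := mem_thicken.1 hq
  obtain ⟨r, hr, h3, h4⟩ := mem_thicken.1 hp
  exact mem_thicken.2 ⟨r, hr, by omega, by omega⟩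

theorem mem_bond {b : Fin (N - 1)} {q : Fin N} : q ∈ bond b ↔ (q : ℕ) = b ∨ (q : ℕ) = b + 1 := by
  simp [bond, Fin.ext_iff]

theorem conj_list_prod_mem_supportedOn {T : Finset (Fin N)} (l : List (QOp (Fin N)))
    (hl : ∀ M ∈ l, ∀ A ∈ supportedOn T, Mᴴ * A * M ∈ supportedOn T) {A : QOp (Fin N)}
    (hA : A ∈ supportedOn T) : l.prodᴴ * A * l.prod ∈ supportedOn T := by
  induction l generalizing A with
  | nil => simpa using hA
  | cons M l ih =>
    rw [List.prod_cons, Matrix.conjTranspose_mul]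
    have := ih (fun M' hM' => hl M' (List.mem_cons_of_mem _ hM')) (hl M List.mem_cons_self A hA)
    simpa only [Matrix.mul_assoc] using this

/-- Conjugation with a layer spreads the support by at most one site. -/
theorem HEA.conj_layer_mem_supportedOn (U : HEA N D) (θ : U.Param) (t : Fin D)
    {S : Finset (Fin N)} {A : QOp (Fin N)} (hA : A ∈ supportedOn S) :
    (U.layer θ t)ᴴ * A * U.layer θ t ∈ supportedOn (thicken 1 S) := by
  classical
  -- `S` enlarged by the gates of this layer that meet it. Each gate of the layer then lies inside
  -- `T` or is disjoint from `T`, so conjugation by any one of them preserves `supportedOn T`,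
  -- whatever the order.
  let T : Finset (Fin N) := Finset.univ.filter fun q => q ∈ S ∨
    ∃ b : Fin (N - 1), (b : ℕ) % 2 = (t : ℕ) % 2 ∧ q ∈ bond b ∧ ∃ p ∈ bond b, p ∈ S
  have hmem : ∀ q, q ∈ T ↔ q ∈ S ∨
      ∃ b : Fin (N - 1), (b : ℕ) % 2 = (t : ℕ) % 2 ∧ q ∈ bond b ∧ ∃ p ∈ bond b, p ∈ S := by
    intro q; simp [T]
  have hST : S ⊆ T := fun q hq => (hmem q).2 (Or.inl hq)
  have hTS : T ⊆ thicken 1 S := by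
    intro q hq
    rcases (hmem q).1 hq with h | ⟨b, -, hb, p, hp, hpS⟩
    · exact mem_thicken.2 ⟨q, h, by omega, by omega⟩
    · rw [mem_bond] at hb hp
      exact mem_thicken.2 ⟨p, hpS, by omega, by omega⟩
  refine supportedOn_mono hTS (conj_list_prod_mem_supportedOn _ ?_ (supportedOn_mono hST hA))
  intro M hM A hA
  obtain ⟨b, rfl⟩ := List.mem_ofFn.1 hM
  split_ifs with hb
  swap
  · simpa using hA
  by_cases hbS : ∃ p ∈ bond b, p ∈ S
  · have hbT : bond b ⊆ T := fun q hq => (hmem q).2 (Or.inr ⟨b, hb, hq, hbS⟩)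
    have hg := supportedOn_mono hbT (actOn_mem_supportedOn (bond b) (U.gate θ t b))
    exact mul_mem_supportedOn (mul_mem_supportedOn (conjTranspose_mem_supportedOn hg) hA) hg
  · have hbT : Disjoint T (bond b) := by
      rw [Finset.disjoint_left]
      intro q hq hqb
      rcases (hmem q).1 hq with h | ⟨b', hb', hqb', hS⟩
      · exact hbS ⟨q, hqb, h⟩
      -- Two bonds of equal parity that share a qubit coincide.
      · have : b' = b := by
          rw [mem_bond] at hqb hqb'
          apply Fin.ext; omega
        exact hbS (this ▸ hS)
    have hg := actOn_mem_unitaryGroup (U.gate_mem_unitaryGroup θ t b)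
    rw [Matrix.mem_unitaryGroup_iff', Matrix.star_eq_conjTranspose] at hg
    rw [Matrix.mul_assoc, commute_of_mem_supportedOn hbT hA (actOn_mem_supportedOn _ _),
      ← Matrix.mul_assoc, hg, Matrix.one_mul]
    exact hA

/-- In the Heisenberg picture the layers act in reverse: the head of `l` conjugates last, on a
support already thickened by the tail. -/
theorem conj_reverse_prod_mem_supportedOn (l : List (QOp (Fin N)))
    (hl : ∀ M ∈ l, ∀ S, ∀ A ∈ supportedOn S, Mᴴ * A * M ∈ supportedOn (thicken 1 S))
    {S : Finset (Fin N)} {A : QOp (Fin N)} (hA : A ∈ supportedOn S) :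
    l.reverse.prodᴴ * A * l.reverse.prod ∈ supportedOn (thicken l.length S) := by
  induction l with
  | nil =>
    have : S ⊆ thicken 0 S := fun q hq => mem_thicken.2 ⟨q, hq, le_rfl, le_rfl⟩
    simpa using supportedOn_mono this hA
  | cons M l ih =>
    rw [List.reverse_cons, List.prod_append, List.prod_singleton, Matrix.conjTranspose_mul]
    have := hl M List.mem_cons_self _ _ (ih fun M' hM' => hl M' (List.mem_cons_of_mem _ hM'))
    simpa only [Matrix.mul_assoc, List.length_cons] using
      supportedOn_mono (thicken_one_thicken_subset _ _) this

/-- The light cone of a circuit of depth `D`. -/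
theorem HEA.conj_unitary_mem_supportedOn (U : HEA N D) (θ : U.Param)
    {S : Finset (Fin N)} {A : QOp (Fin N)} (hA : A ∈ supportedOn S) :
    (U.unitary θ)ᴴ * A * U.unitary θ ∈ supportedOn (thicken D S) := by
  have := conj_reverse_prod_mem_supportedOn (List.ofFn fun t : Fin D => U.layer θ t) (S := S)
    (fun M hM S A hA => ?_) hA
  · rw [List.length_ofFn] at this
    exact this
  · obtain ⟨t, rfl⟩ := List.mem_ofFn.1 hM
    exact U.conj_layer_mem_supportedOn θ t hA

end LightCone

/-! ### Consequences of small Pauli expectations -/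

section Bounds

/-- The Pauli expectation value `⟨ψ| P |ψ⟩`. -/
def pauliExpect {n : ℕ} (ψ : QState n) (P : Fin n → Pauli) : ℂ :=
  star ψ.1.ofLp ⬝ᵥ (pauliOp P *ᵥ ψ.1.ofLp)

theorem pauliExpect_const_I {n : ℕ} (ψ : QState n) : pauliExpect ψ (fun _ => Pauli.I) = 1 := by
  have h : ‖ψ.1‖ = 1 := by simp
  have h2 : inner ℂ ψ.1 ψ.1 = (1 : ℂ) := by rw [inner_self_eq_norm_sq_to_K, h]; simp
  rw [pauliExpect, pauliOp_const_I, Matrix.one_mulVec, dotProduct_comm,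
    ← EuclideanSpace.inner_eq_star_dotProduct, h2]

theorem trace_twoCopies_mul_pauliOp {n : ℕ} (ψ : QState n) (P : Fin (n + n) → Pauli) :
    (twoCopies ψ * pauliOp P).trace =
      pauliExpect ψ (fun q => P (Fin.castAdd n q)) * pauliExpect ψ (fun q => P (Fin.natAdd n q)) := by
  rw [Matrix.trace_mul_comm]
  simp only [pauliExpect, dotProduct, mulVec, Matrix.trace, Matrix.diag, Matrix.mul_apply, twoCopies,
    Matrix.vecMulVec_apply]
  rw [← (Fin.appendEquiv n n).sum_comp, Fintype.sum_prod_type, Finset.sum_mul_sum]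
  refine Finset.sum_congr rfl fun x _ => Finset.sum_congr rfl fun y _ => ?_
  rw [← (Fin.appendEquiv n n).sum_comp, Fintype.sum_prod_type, mul_mul_mul_comm, Finset.sum_mul_sum,
    Finset.mul_sum]
  refine Finset.sum_congr rfl fun z _ => ?_
  rw [Finset.mul_sum]
  refine Finset.sum_congr rfl fun w _ => ?_
  simp only [pauliOp, twoCopyVec, Fin.appendEquiv, Equiv.coe_fn_mk, Fin.prod_univ_add,
    Fin.append_left, Fin.append_right, Pi.star_apply, star_mul']
  ring

/-- The trace is a product of two single-copy expectations. At least one half of `P` is nontrivial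
and contributes `ε`; the other contributes at most `1`. -/
theorem norm_trace_twoCopies_mul_pauliOp_le {n : ℕ} {ψ : QState n} {ε : ℝ} (hε : ε ≤ 1)
    (hψ : ∀ Q : Fin n → Pauli, Q ≠ (fun _ => Pauli.I) → ‖pauliExpect ψ Q‖ ≤ ε)
    {P : Fin (n + n) → Pauli} (hP : P ≠ fun _ => Pauli.I) :
    ‖(twoCopies ψ * pauliOp P).trace‖ ≤ ε := by
  have hle : ∀ Q : Fin n → Pauli, ‖pauliExpect ψ Q‖ ≤ 1 := by
    intro Q
    by_cases hQ : Q = fun _ => Pauli.I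
    · rw [hQ, pauliExpect_const_I, norm_one]
    · exact (hψ Q hQ).trans hε
  rw [trace_twoCopies_mul_pauliOp, norm_mul]
  by_cases h1 : (fun q => P (Fin.castAdd n q)) = fun _ => Pauli.I
  · by_cases h2 : (fun q => P (Fin.natAdd n q)) = fun _ => Pauli.I
    · refine absurd (funext fun q => ?_) hP
      refine Fin.addCases (fun i => ?_) (fun i => ?_) q
      · exact congrFun h1 i
      · exact congrFun h2 i
    · exact (mul_le_of_le_one_left (norm_nonneg _) (hle _)).trans (hψ _ h2)
  · exact (mul_le_of_le_one_right (norm_nonneg _) (hle _)).trans (hψ _ h1)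

theorem trace_twoCopies {n : ℕ} (ψ : QState n) : (twoCopies ψ).trace = 1 := by
  have := trace_twoCopies_mul_pauliOp ψ (fun _ => Pauli.I)
  rwa [pauliOp_const_I, mul_one, pauliExpect_const_I, mul_one] at this

-- Cauchy–Schwarz on the singular values, whose squares sum to the squared Frobenius norm.
open scoped ComplexOrder in
theorem traceNorm_sq_le {m : Type} [Fintype m] [DecidableEq m] (A : Matrix m m ℂ) :
    traceNorm A ^ 2 ≤ Fintype.card m * ∑ i, ∑ j, ‖A i j‖ ^ 2 := by
  have hA := Matrix.isHermitian_conjTranspose_mul_self A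
  have h := sq_sum_le_card_mul_sum_sq (s := (Finset.univ : Finset m))
    (f := fun i => Real.sqrt (hA.eigenvalues i))
  have hs : ∑ i, Real.sqrt (hA.eigenvalues i) ^ 2 = ∑ i, ∑ j, ‖A i j‖ ^ 2 := by
    have h1 := hA.trace_eq_sum_eigenvalues
    rw [trace_conjTranspose_mul_self] at h1
    simp_rw [Real.sq_sqrt ((Matrix.posSemidef_conjTranspose_mul_self A).eigenvalues_nonneg _)]
    apply Complex.ofReal_injective
    rw [h1]
    push_cast
    rfl
  rw [hs, Finset.card_univ] at h
  exact h

/-- All `4^|Λ|` Pauli traces of the deviation are at most `ε`, so by Parseval its squared Frobenius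
norm is at most `2^|Λ| ε²`; the trace norm costs one more factor `2^|Λ|` in the square. -/
theorem infoMeasure_le {N : ℕ} {ρ : QOp (Fin N)} {ε : ℝ} (hε : 0 ≤ ε) (hρ : ρ.trace = 1)
    (h : ∀ P : Fin N → Pauli, P ≠ (fun _ => Pauli.I) → ‖(ρ * pauliOp P).trace‖ ≤ ε)
    (Λ : Finset (Fin N)) : infoMeasure Λ ρ ≤ 2 ^ Λ.card * ε := by
  refine le_of_sq_le_sq ((traceNorm_sq_le _).trans ?_) (by positivity)
  set A := reduced Λ ρ - ((2 : ℂ) ^ Λ.card)⁻¹ • (1 : QOp Λ)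
  have hc : Fintype.card Λ = Λ.card := Fintype.card_coe Λ
  have hA : ∀ P : Λ → Pauli, ‖(A * pauliOp P).trace‖ ≤ ε := by
    intro P
    rw [sub_mul, Matrix.trace_sub, trace_reduced_mul, smul_mul_assoc, one_mul, Matrix.trace_smul]
    by_cases hP : P = fun _ => Pauli.I
    · rw [hP, pauliOp_const_I, actOn_one, mul_one, hρ, Matrix.trace_one]
      simp [hε]
    · rw [trace_pauliOp hP, smul_zero, sub_zero, actOn_pauliOp]
      refine h _ fun h0 => hP (funext fun q => ?_)
      have := congrFun h0 q
      simpa [extendPauli] using this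
  have hp := pauli_parseval A
  rw [Fintype.card_pi, Finset.prod_const, Finset.card_univ, Fintype.card_fin, hc]
  rw [hc] at hp
  push_cast
  rw [← hp]
  calc ∑ P : Λ → Pauli, ‖(A * pauliOp P).trace‖ ^ 2
      ≤ ∑ P : Λ → Pauli, ε ^ 2 := by
        gcongr with P _
        exact hA P
    _ = (2 ^ Λ.card * ε) ^ 2 := by
        have : Fintype.card Pauli = 4 := rfl
        rw [Finset.sum_const, Finset.card_univ, Fintype.card_pi, Finset.prod_const, this,
          Finset.card_univ, hc, nsmul_eq_mul, mul_pow, ← pow_mul, mul_comm Λ.card, pow_mul]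
        norm_num

theorem card_pauliSupp_le_le (N L : ℕ) :
    (Finset.univ.filter fun P : Fin N → Pauli => (pauliSupp P).card ≤ L).card ≤
      (4 * N + 1) ^ L := by
  induction L with
  | zero =>
    rw [pow_zero, Finset.card_le_one]
    have : ∀ P : Fin N → Pauli, (pauliSupp P).card ≤ 0 → P = fun _ => Pauli.I := by
      intro P hP
      rw [Nat.le_zero, Finset.card_eq_zero] at hP
      funext q
      by_contra hq
      have : q ∈ pauliSupp P := by simpa [pauliSupp] using hq
      simp [hP] at this
    intro P hP Q hQ
    rw [this P (Finset.mem_filter.1 hP).2, this Q (Finset.mem_filter.1 hQ).2]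
  | succ L ih =>
    set F := Finset.univ.filter fun P : Fin N → Pauli => (pauliSupp P).card ≤ L
    -- A label of weight `L + 1` arises from one of weight `L` by resetting one site: at most `4N`
    -- choices, plus `1` for labels already of weight at most `L`.
    have hsub : (Finset.univ.filter fun P : Fin N → Pauli => (pauliSupp P).card ≤ L + 1) ⊆
        F ∪ (F ×ˢ (Finset.univ : Finset (Fin N × Pauli))).image
          fun x => Function.update x.1 x.2.1 x.2.2 := by
      intro P hP
      have hP := (Finset.mem_filter.1 hP).2
      by_cases h : (pauliSupp P).card ≤ L
      · exact Finset.mem_union_left _ (by simp [F, h])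
      · obtain ⟨q, hq⟩ : (pauliSupp P).Nonempty := by
          rw [← Finset.card_pos]; omega
        refine Finset.mem_union_right _ (Finset.mem_image.2
          ⟨(Function.update P q .I, q, P q), ?_, by simp⟩)
        simp only [F, Finset.mem_product, Finset.mem_filter, Finset.mem_univ, true_and, and_true]
        have hss : pauliSupp (Function.update P q .I) ⊆ (pauliSupp P).erase q := by
          intro k hk
          have hk : Function.update P q .I k ≠ .I := by simpa [pauliSupp] using hk
          by_cases hkq : k = q
          · rw [hkq, Function.update_self] at hk; exact absurd rfl hk
          · rw [Function.update_of_ne hkq] at hk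
            simp [pauliSupp, hkq, hk]
        have := Finset.card_le_card hss
        rw [Finset.card_erase_of_mem hq] at this
        omega
    refine (Finset.card_le_card hsub).trans ((Finset.card_union_le _ _).trans ?_)
    have h1 : ((F ×ˢ (Finset.univ : Finset (Fin N × Pauli))).image
          fun x => Function.update x.1 x.2.1 x.2.2).card ≤ F.card * (N * 4) := by
      refine Finset.card_image_le.trans ?_
      have : Fintype.card Pauli = 4 := rfl
      rw [Finset.card_product, Finset.card_univ, Fintype.card_prod, Fintype.card_fin, this]
    calc _ ≤ F.card + F.card * (N * 4) := Nat.add_le_add_left h1 _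
      _ = F.card * (4 * N + 1) := by ring
      _ ≤ _ := by rw [pow_succ]; gcongr

/-- Each column is the image of a unit basis vector. -/
theorem sum_norm_sq_le_opNorm {m : Type} [Fintype m] [DecidableEq m] (A : Matrix m m ℂ) :
    ∑ i, ∑ j, ‖A i j‖ ^ 2 ≤ Fintype.card m * opNorm A ^ 2 := by
  rw [Finset.sum_comm]
  have h : ∀ j, ∑ i, ‖A i j‖ ^ 2 ≤ opNorm A ^ 2 := by
    intro j
    have h1 := (Matrix.toEuclideanCLM (n := m) (𝕜 := ℂ) A).le_opNorm (EuclideanSpace.single j 1)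
    rw [PiLp.norm_single, norm_one, mul_one] at h1
    have h2 := pow_le_pow_left₀ (norm_nonneg _) h1 2
    rw [EuclideanSpace.norm_sq_eq] at h2
    refine le_trans (le_of_eq (Finset.sum_congr rfl fun i _ => ?_)) h2
    rw [Matrix.ofLp_toEuclideanCLM]
    simp
  refine (Finset.sum_le_sum fun j _ => h j).trans ?_
  simp

/-- An operator with Pauli weights at most `L` is insensitive to a state whose nontrivial Pauli
expectation values are small. -/
theorem norm_trace_mul_sub_le {N L : ℕ} {ρ M : QOp (Fin N)} {ε : ℝ} (hε : 0 ≤ ε)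
    (hρ : ρ.trace = 1)
    (h : ∀ P : Fin N → Pauli, P ≠ (fun _ => Pauli.I) → ‖(ρ * pauliOp P).trace‖ ≤ ε)
    (hM : ∀ P : Fin N → Pauli, L < (pauliSupp P).card → (M * pauliOp P).trace = 0)
    {B : ℝ} (hB : 0 ≤ B) (hMB : ∑ i, ∑ j, ‖M i j‖ ^ 2 ≤ 2 ^ N * B ^ 2) :
    ‖(ρ * M).trace - M.trace / 2 ^ N‖ ≤
      ε * Real.sqrt (Finset.univ.filter fun P : Fin N → Pauli => (pauliSupp P).card ≤ L).card * B := by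
  classical
  set F := Finset.univ.filter fun P : Fin N → Pauli => (pauliSupp P).card ≤ L
  set m : (Fin N → Pauli) → ℂ := fun P => (M * pauliOp P).trace / 2 ^ N with hm
  have hexp : (ρ * M).trace = ∑ P, m P * (ρ * pauliOp P).trace := by
    conv_lhs => rw [pauli_expansion M]
    simp only [Finset.mul_sum, Matrix.trace_sum, Matrix.mul_smul, Matrix.trace_smul,
      Fintype.card_fin, smul_eq_mul, hm]
  have hI : M.trace / 2 ^ N = m (fun _ => .I) * (ρ * pauliOp fun _ => .I).trace := by
    simp only [hm, pauliOp_const_I, mul_one, hρ]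
  -- The trivial value is exactly the identity term of the Pauli expansion.
  have hdiff : (ρ * M).trace - M.trace / 2 ^ N =
      ∑ P ∈ Finset.univ.erase (fun _ => Pauli.I), m P * (ρ * pauliOp P).trace := by
    rw [hexp, hI, ← Finset.add_sum_erase _ _ (Finset.mem_univ (fun _ : Fin N => Pauli.I))]
    ring
  have hsq : ∑ P, ‖m P‖ ^ 2 ≤ B ^ 2 := by
    have hp := pauli_parseval M
    rw [Fintype.card_fin] at hp
    have : ∀ P, ‖m P‖ ^ 2 = ‖(M * pauliOp P).trace‖ ^ 2 / (2 ^ N * 2 ^ N) := by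
      intro P
      rw [hm, norm_div, div_pow, norm_pow, Complex.norm_ofNat, pow_two (2 ^ N : ℝ)]
    simp_rw [this]
    rw [← Finset.sum_div, hp, div_le_iff₀ (by positivity), mul_comm (B ^ 2), mul_assoc]
    gcongr
  have hF : ∑ P ∈ F, ‖m P‖ ≤ Real.sqrt F.card * B := by
    refine le_of_sq_le_sq ?_ (by positivity)
    rw [mul_pow, Real.sq_sqrt (Nat.cast_nonneg _)]
    refine sq_sum_le_card_mul_sum_sq.trans ?_
    gcongr
    exact (Finset.sum_le_univ_sum_of_nonneg fun P => by positivity).trans hsq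
  have hzero : ∀ P, P ∉ F → m P = 0 := by
    intro P hP
    have : L < (pauliSupp P).card := by simpa [F] using hP
    rw [hm]; simp only [hM P this, zero_div]
  rw [hdiff]
  calc _ ≤ ∑ P ∈ Finset.univ.erase (fun _ => Pauli.I), ‖m P‖ * ε := by
        refine (norm_sum_le _ _).trans (Finset.sum_le_sum fun P hP => ?_)
        rw [norm_mul]
        gcongr
        exact h P (Finset.ne_of_mem_erase hP)
    _ ≤ ∑ P, ‖m P‖ * ε := Finset.sum_le_univ_sum_of_nonneg fun P => by positivity
    _ = (∑ P ∈ F, ‖m P‖) * ε := by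
        rw [← Finset.sum_mul]
        congr 1
        exact (Finset.sum_subset (Finset.subset_univ F) fun P _ hP => by simp [hzero P hP]).symm
    _ ≤ (Real.sqrt F.card * B) * ε := by gcongr
    _ = _ := by ring

/-- The cost function is close to its trivial value for a state whose nontrivial Pauli
expectation values are small. -/
theorem HEA.norm_cost_sub_le {N D s : ℕ} (U : HEA N D) {ρ O : QOp (Fin N)} {ε : ℝ} (hε : 0 ≤ ε)
    (hρ : ρ.trace = 1)
    (h : ∀ P : Fin N → Pauli, P ≠ (fun _ => Pauli.I) → ‖(ρ * pauliOp P).trace‖ ≤ ε)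
    (hO : ∀ P : Fin N → Pauli, pauliCoeff O P ≠ 0 → (pauliSupp P).card ≤ s) (θ : U.Param) :
    ‖U.cost ρ O θ - trivialValue O‖ ≤
      ε * Real.sqrt (Finset.univ.filter fun P : Fin N → Pauli =>
        (pauliSupp P).card ≤ s * (2 * D + 1)).card * opNorm O := by
  set W := U.unitary θ
  have hW := U.unitary_mem_unitaryGroup θ
  have hW1 : Wᴴ * W = 1 := (Matrix.mem_unitaryGroup_iff').1 hW
  have hW2 : W * Wᴴ = 1 := (Matrix.mem_unitaryGroup_iff).1 hW
  have hcost : U.cost ρ O θ = (ρ * (Wᴴ * O * W)).trace := by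
    rw [HEA.cost, Matrix.mul_assoc, Matrix.mul_assoc, Matrix.trace_mul_comm]
    simp only [Matrix.mul_assoc]
    rfl
  have htr : (Wᴴ * O * W).trace = O.trace := by
    rw [Matrix.trace_mul_comm, ← Matrix.mul_assoc, hW2, one_mul]
  -- Only the Frobenius norm has to be carried through the circuit; the operator norm enters
  -- afterwards, for `O` itself.
  have hfro : ∑ i, ∑ j, ‖(Wᴴ * O * W) i j‖ ^ 2 = ∑ i, ∑ j, ‖O i j‖ ^ 2 := by
    apply Complex.ofReal_injective
    rw [← trace_conjTranspose_mul_self, ← trace_conjTranspose_mul_self]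
    have : (Wᴴ * O * W)ᴴ * (Wᴴ * O * W) = Wᴴ * (Oᴴ * O) * W := by
      simp only [Matrix.conjTranspose_mul, Matrix.conjTranspose_conjTranspose, Matrix.mul_assoc]
      rw [← Matrix.mul_assoc W, hW2, one_mul]
    rw [this, Matrix.trace_mul_comm, ← Matrix.mul_assoc, hW2, one_mul]
  rw [hcost, trivialValue, ← htr]
  refine norm_trace_mul_sub_le hε hρ h ?_ (norm_nonneg _) ?_
  · intro Q hQ
    rw [pauli_expansion O]
    simp only [Finset.mul_sum, Finset.sum_mul, Matrix.trace_sum]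
    refine Finset.sum_eq_zero fun P _ => ?_
    rw [Matrix.mul_smul, Matrix.smul_mul, Matrix.smul_mul, Matrix.trace_smul]
    by_cases hP : pauliCoeff O P = 0
    · rw [Fintype.card_fin]
      change pauliCoeff O P • _ = _
      rw [hP, zero_smul]
    · rw [trace_mul_pauliOp_of_mem_supportedOn
        (U.conj_unitary_mem_supportedOn θ (pauliOp_mem_supportedOn_supp P)), smul_zero]
      intro hsub
      have h1 := (Finset.card_le_card hsub).trans (card_thicken_le D _)
      have h2 := Nat.mul_le_mul_right (2 * D + 1) (hO P hP)
      omega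
  · rw [hfro]
    refine (sum_norm_sq_le_opNorm O).trans (le_of_eq ?_)
    simp

end Bounds

/-! ### Concentration of Pauli expectations in a random state -/

section Haar

/-- A Pauli operator as a real linear map on the space of states. -/
noncomputable def pauliRealLinear {n : ℕ} (P : Fin n → Pauli) : QSpace n →ₗ[ℝ] QSpace n :=
  ((Matrix.toEuclideanCLM (n := Fin n → Fin 2) (𝕜 := ℂ) (pauliOp P)).toLinearMap).restrictScalars ℝ

theorem pauliRealLinear_apply {n : ℕ} (P : Fin n → Pauli) (x : QSpace n) :
    pauliRealLinear P x = Matrix.toEuclideanCLM (n := Fin n → Fin 2) (𝕜 := ℂ) (pauliOp P) x := rfl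

theorem pauliRealLinear_mul_self {n : ℕ} (P : Fin n → Pauli) :
    pauliRealLinear P * pauliRealLinear P = 1 := by
  refine LinearMap.ext fun x => ?_
  rw [Module.End.mul_apply, pauliRealLinear_apply, pauliRealLinear_apply,
    ← mul_apply_eq_comp, ← map_mul, pauliOp_mul_self, map_one]
  rfl

theorem pauliRealLinear_anticommute {n : ℕ} {P R : Fin n → Pauli}
    (h : pauliOp R * pauliOp P = -(pauliOp P * pauliOp R)) :
    pauliRealLinear R * pauliRealLinear P = -(pauliRealLinear P * pauliRealLinear R) := by
  refine LinearMap.ext fun x => ?_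
  rw [LinearMap.neg_apply, Module.End.mul_apply, Module.End.mul_apply]
  simp only [pauliRealLinear_apply]
  rw [← mul_apply_eq_comp, ← map_mul, h, map_neg, map_mul]
  rfl

/-- The quadratic form `⟨x| P |x⟩` on all vectors. -/
noncomputable def pauliForm {n : ℕ} (P : Fin n → Pauli) (x : QSpace n) : ℝ :=
  (inner ℂ x (Matrix.toEuclideanCLM (n := Fin n → Fin 2) (𝕜 := ℂ) (pauliOp P) x)).re

theorem continuous_pauliForm {n : ℕ} (P : Fin n → Pauli) : Continuous (pauliForm P) := by
  unfold pauliForm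
  fun_prop

theorem pauliForm_smul {n : ℕ} (P : Fin n → Pauli) (c : ℝ) (x : QSpace n) :
    pauliForm P (c • x) = c ^ 2 * pauliForm P x := by
  have : c • x = (c : ℂ) • x := by ext i; simp
  rw [pauliForm, this, map_smul, inner_smul_left, inner_smul_right, Complex.conj_ofReal,
    ← mul_assoc, ← Complex.ofReal_mul, Complex.re_ofReal_mul, pauliForm, pow_two]

theorem inner_toEuclideanCLM_conjTranspose {m : Type} [Fintype m] [DecidableEq m]
    (A : Matrix m m ℂ) (x y : EuclideanSpace ℂ m) :
    inner ℂ (Matrix.toEuclideanCLM (n := m) (𝕜 := ℂ) A x) y =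
      inner ℂ x (Matrix.toEuclideanCLM (n := m) (𝕜 := ℂ) Aᴴ y) := by
  rw [← Matrix.star_eq_conjTranspose, map_star, ContinuousLinearMap.star_eq_adjoint,
    ContinuousLinearMap.adjoint_inner_right]

/-- Pauli operators are isometries; this is the hypothesis `hq` of `measure_cone_le`. -/
theorem norm_sub_smul_pauliRealLinear_sq {n : ℕ} (P : Fin n → Pauli) (b : ℝ) (x : QSpace n) :
    ‖x - b • pauliRealLinear P x‖ ^ 2 = (1 + b ^ 2) * ‖x‖ ^ 2 - 2 * b * pauliForm P x := by
  set T := Matrix.toEuclideanCLM (n := Fin n → Fin 2) (𝕜 := ℂ) (pauliOp P)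
  have h0 : b • pauliRealLinear P x = (b : ℂ) • T x := by
    ext i; simp [pauliRealLinear_apply, T]
  have h1 : ‖T x‖ ^ 2 = ‖x‖ ^ 2 := by
    have h : inner ℂ (T x) (T x) = inner ℂ x x := by
      rw [inner_toEuclideanCLM_conjTranspose, conjTranspose_pauliOp,
        ← mul_apply_eq_comp, ← map_mul, pauliOp_mul_self, map_one]
      rfl
    rw [inner_self_eq_norm_sq_to_K, inner_self_eq_norm_sq_to_K] at h
    exact_mod_cast h
  have h2 : RCLike.re (inner ℂ x ((b : ℂ) • T x)) = b * pauliForm P x := by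
    rw [inner_smul_right]
    exact Complex.re_ofReal_mul _ _
  rw [h0, norm_sub_sq (𝕜 := ℂ), h2, norm_smul, mul_pow, h1, Complex.norm_real, Real.norm_eq_abs,
    sq_abs]
  ring

theorem pauliExpect_eq_pauliForm {n : ℕ} (ψ : QState n) (P : Fin n → Pauli) :
    pauliExpect ψ P = (pauliForm P ψ.1 : ℂ) := by
  set T := Matrix.toEuclideanCLM (n := Fin n → Fin 2) (𝕜 := ℂ) (pauliOp P)
  have h1 : pauliExpect ψ P = inner ℂ ψ.1 (T ψ.1) := by
    rw [EuclideanSpace.inner_eq_star_dotProduct, dotProduct_comm]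
    rfl
  have h2 : star (inner ℂ ψ.1 (T ψ.1)) = inner ℂ ψ.1 (T ψ.1) := by
    have := inner_toEuclideanCLM_conjTranspose (pauliOp P) ψ.1 ψ.1
    rw [conjTranspose_pauliOp] at this
    exact (inner_conj_symm _ _).trans this
  rw [h1]
  exact (Complex.conj_eq_iff_re.1 h2).symm

theorem finrank_real_QSpace (n : ℕ) : Module.finrank ℝ (QSpace n) = 2 * 2 ^ n := by
  have h : Module.finrank ℝ (QSpace n) = 2 * Module.finrank ℂ (QSpace n) :=
    finrank_real_of_complex _
  rw [h, finrank_euclideanSpace]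
  simp

/-- Concentration of the expectation value of a nontrivial Pauli operator in a random state. -/
theorem haarState_lt_norm_pauliExpect_le {n : ℕ} {P : Fin n → Pauli}
    (hP : P ≠ fun _ => Pauli.I) {ε : ℝ} (hε0 : 0 < ε) (hε1 : ε ≤ 1) :
    haarState n {ψ | ε < ‖pauliExpect ψ P‖} ≤
      ENNReal.ofReal (2 * Real.exp (-(ε ^ 2 * 2 ^ n / 2))) := by
  obtain ⟨R, hR⟩ := exists_pauliOp_anticommute hP
  have hRQ := pauliRealLinear_anticommute hR
  have hd : ε ^ 2 * (Module.finrank ℝ (QSpace n) : ℝ) / 4 = ε ^ 2 * 2 ^ n / 2 := by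
    rw [finrank_real_QSpace]; push_cast; ring
  have h1 := toSphere_normalized_le (volume : Measure (QSpace n)) (pauliRealLinear P)
    (pauliRealLinear R) (pauliRealLinear_mul_self P) (pauliRealLinear_mul_self R) hRQ
    (pauliForm P) (continuous_pauliForm P) (pauliForm_smul P)
    (norm_sub_smul_pauliRealLinear_sq P) hε0 hε1
  -- The lower tail is the upper tail of `-P`, which anticommutes with the same `R`.
  have h2 := toSphere_normalized_le (volume : Measure (QSpace n)) (-pauliRealLinear P)
    (pauliRealLinear R) (by rw [neg_mul_neg]; exact pauliRealLinear_mul_self P)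
    (pauliRealLinear_mul_self R) (by rw [mul_neg, hRQ, neg_mul])
    (fun x => -pauliForm P x) (continuous_pauliForm P).neg
    (fun c x => by rw [pauliForm_smul]; ring)
    (fun b x => by
      have := norm_sub_smul_pauliRealLinear_sq P (-b) x
      rw [LinearMap.neg_apply, smul_neg, ← neg_smul, this]; ring) hε0 hε1
  rw [hd] at h1 h2
  have hsub : {ψ : QState n | ε < ‖pauliExpect ψ P‖} ⊆
      {ψ | ε < pauliForm P ψ.1} ∪ {ψ | ε < -pauliForm P ψ.1} := by
    intro ψ hψ
    have hψ : ε < ‖pauliExpect ψ P‖ := hψ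
    rw [pauliExpect_eq_pauliForm, Complex.norm_real, Real.norm_eq_abs] at hψ
    exact lt_abs.1 hψ
  refine (measure_mono hsub).trans ((measure_union_le _ _).trans ((add_le_add h1 h2).trans ?_))
  rw [← ENNReal.ofReal_add (Real.exp_nonneg _) (Real.exp_nonneg _), two_mul]

instance (n : ℕ) : IsProbabilityMeasure (haarState n) where
  measure_univ := by
    rw [haarState, Measure.smul_apply, smul_eq_mul]
    refine ENNReal.inv_mul_cancel (fun h => ?_) (measure_ne_top _ _)
    exact Measure.toSphere_ne_zero (volume : Measure (QSpace n)) (Measure.measure_univ_eq_zero.1 h)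

/-- With high probability, all nontrivial Pauli expectation values are small. -/
theorem haarState_real_pauliExpect_le (n : ℕ) {ε : ℝ} (hε0 : 0 < ε) (hε1 : ε ≤ 1) :
    1 - 4 ^ n * (2 * Real.exp (-(ε ^ 2 * 2 ^ n / 2))) ≤
      (haarState n).real
        {ψ | ∀ P : Fin n → Pauli, P ≠ (fun _ => Pauli.I) → ‖pauliExpect ψ P‖ ≤ ε} := by
  set G := {ψ : QState n | ∀ P : Fin n → Pauli, P ≠ (fun _ => Pauli.I) → ‖pauliExpect ψ P‖ ≤ ε}
  set B : (Fin n → Pauli) → Set (QState n) := fun P =>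
    {ψ | P ≠ (fun _ => Pauli.I) ∧ ε < ‖pauliExpect ψ P‖}
  have hcover : (Set.univ : Set (QState n)) ⊆ G ∪ ⋃ P, B P := by
    intro ψ _
    by_cases h : ψ ∈ G
    · exact Or.inl h
    · have h : ¬ ∀ P : Fin n → Pauli, P ≠ (fun _ => Pauli.I) → ‖pauliExpect ψ P‖ ≤ ε := h
      push Not at h
      obtain ⟨P, hP, hlt⟩ := h
      exact Or.inr (Set.mem_iUnion.2 ⟨P, hP, hlt⟩)
  have hB : ∀ P, (haarState n).real (B P) ≤ 2 * Real.exp (-(ε ^ 2 * 2 ^ n / 2)) := by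
    intro P
    by_cases hP : P = fun _ => Pauli.I
    · have : B P = ∅ := Set.eq_empty_of_forall_notMem fun ψ hψ => hψ.1 hP
      rw [this, measureReal_empty]
      positivity
    · refine ENNReal.toReal_le_of_le_ofReal (by positivity) ?_
      exact (measure_mono fun ψ hψ => hψ.2).trans (haarState_lt_norm_pauliExpect_le hP hε0 hε1)
  have h1 := (measureReal_mono (μ := haarState n) hcover).trans (measureReal_union_le _ _)
  have h2 := (measureReal_iUnion_fintype_le (μ := haarState n) B).trans
    (Finset.sum_le_sum fun P _ => hB P)
  have hc : Fintype.card Pauli = 4 := rfl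
  rw [Finset.sum_const, Finset.card_univ, Fintype.card_pi, Finset.prod_const, hc, Finset.card_univ,
    Fintype.card_fin, nsmul_eq_mul] at h2
  rw [probReal_univ] at h1
  push_cast at h2
  linarith

end Haar

/-! ### Counting low-weight Pauli operators asymptotically -/

section Asymptotics

/-- The count is at most `(8n+1)^(s(2D+1))`, whose logarithm is `O(log³ n) = o(n)`. -/
theorem exists_sqrt_card_le (D s : ℕ → ℕ)
    (hD : (fun n => (D n : ℝ)) =O[atTop] fun n : ℕ => Real.log n)
    (hs : (fun n => (s n : ℝ)) =O[atTop] fun n : ℕ => Real.log n) :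
    ∃ K : ℝ, ∀ n : ℕ, Real.sqrt (Finset.univ.filter fun P : Fin (n + n) → Pauli =>
        (pauliSupp P).card ≤ s n * (2 * D n + 1)).card ≤ K * (2 : ℝ) ^ ((n : ℝ) / 6) := by
  have hlog : Tendsto (fun n : ℕ => Real.log n) atTop atTop :=
    Real.tendsto_log_atTop.comp tendsto_natCast_atTop_atTop
  have h1 : (fun _ : ℕ => (1 : ℝ)) =O[atTop] fun n : ℕ => Real.log n :=
    IsBigO.of_bound 1 (by
      filter_upwards [hlog.eventually_ge_atTop 1] with n hn
      rw [norm_one, one_mul, Real.norm_eq_abs]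
      exact hn.trans (le_abs_self _))
  have h2D : (fun n => (2 * D n + 1 : ℝ)) =O[atTop] fun n : ℕ => Real.log n :=
    (hD.const_mul_left 2).add h1
  have hl8 : (fun n : ℕ => Real.log (8 * n + 1)) =O[atTop] fun n : ℕ => Real.log n := by
    refine IsBigO.of_bound 2 ?_
    filter_upwards [eventually_ge_atTop 9] with n hn
    have hn' : (9 : ℝ) ≤ n := by exact_mod_cast hn
    rw [Real.norm_of_nonneg (Real.log_nonneg (by linarith)),
      Real.norm_of_nonneg (Real.log_nonneg (by linarith))]
    have : 2 * Real.log (n : ℝ) = Real.log ((n : ℝ) ^ 2) := by rw [Real.log_pow]; norm_num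
    rw [this]
    exact Real.log_le_log (by linarith) (by nlinarith)
  have hlit : (fun n : ℕ => ((s n : ℝ) * (2 * D n + 1)) * Real.log (8 * n + 1))
      =o[atTop] fun n : ℕ => (n : ℝ) := by
    refine ((hs.mul h2D).mul hl8).trans_isLittleO ?_
    have := (Real.isLittleO_pow_log_id_atTop (n := 3)).comp_tendsto
      (tendsto_natCast_atTop_atTop (R := ℝ))
    refine this.congr (fun n => ?_) fun n => rfl
    simp only [Function.comp]
    ring
  set a : ℕ → ℝ := fun n => Real.sqrt (Finset.univ.filter fun P : Fin (n + n) → Pauli =>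
        (pauliSupp P).card ≤ s n * (2 * D n + 1)).card with ha
  have hev : ∀ᶠ n : ℕ in atTop, a n ≤ (2 : ℝ) ^ ((n : ℝ) / 6) := by
    -- The constant `log 2 / 3` bounds the count by `2^(n/3)`, hence its root by `2^(n/6)`.
    filter_upwards [hlit.bound (show 0 < Real.log 2 / 3 by positivity)] with n hn
    have hlpos : 0 ≤ Real.log (8 * (n : ℝ) + 1) :=
      Real.log_nonneg (by linarith [Nat.cast_nonneg (α := ℝ) n])
    rw [Real.norm_of_nonneg (by positivity), Real.norm_of_nonneg (by positivity)] at hn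
    rw [ha]
    refine Real.sqrt_le_iff.2 ⟨by positivity, ?_⟩
    have hc : ((Finset.univ.filter fun P : Fin (n + n) → Pauli =>
        (pauliSupp P).card ≤ s n * (2 * D n + 1)).card : ℝ) ≤
        (8 * n + 1) ^ (s n * (2 * D n + 1)) := by
      have := card_pauliSupp_le_le (n + n) (s n * (2 * D n + 1))
      have h8 : 4 * (n + n) + 1 = 8 * n + 1 := by ring
      rw [h8] at this
      exact_mod_cast this
    refine hc.trans ?_
    rw [← Real.rpow_natCast, ← Real.rpow_mul_natCast zero_le_two,
      Real.rpow_def_of_pos (by positivity), Real.rpow_def_of_pos two_pos]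
    refine Real.exp_le_exp.2 ?_
    push_cast
    linarith
  obtain ⟨n₀, hn₀⟩ := eventually_atTop.1 hev
  -- The `1` serves `n ≥ n₀`; the sum absorbs the finitely many smaller `n`.
  refine ⟨1 + ∑ k ∈ Finset.range n₀, a k, fun n => ?_⟩
  have ha0 : ∀ k, 0 ≤ a k := fun k => Real.sqrt_nonneg _
  have hsum : 0 ≤ ∑ k ∈ Finset.range n₀, a k := Finset.sum_nonneg fun k _ => ha0 k
  have hpow : 1 ≤ (2 : ℝ) ^ ((n : ℝ) / 6) := Real.one_le_rpow one_le_two (by positivity)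
  change a n ≤ _
  rcases le_or_gt n₀ n with h | h
  · refine (hn₀ n h).trans ?_
    nlinarith
  · have := Finset.single_le_sum (f := a) (fun k _ => ha0 k) (Finset.mem_range.2 h)
    nlinarith

end Asymptotics

/-! ### The two-copy theorem -/

theorem corollary3 (D s : ℕ → ℕ)
    (hD : (fun n => (D n : ℝ)) =O[atTop] fun n : ℕ => Real.log n)
    (hs : (fun n => (s n : ℝ)) =O[atTop] fun n : ℕ => Real.log n) :
    ∃ K : ℝ, ∀ (n : ℕ) (U : HEA (n + n) (D n)) (O : QOp (Fin (n + n))),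
      O.IsHermitian →
      (∀ P : Fin (n + n) → Pauli, pauliCoeff O P ≠ 0 → (pauliSupp P).card ≤ s n) →
      1 - Real.exp (-((18 * Real.pi ^ 3)⁻¹ * (2 : ℝ) ^ ((n : ℝ) / 3 - 4)) +
            (2 * (n : ℝ) + 1) * Real.log 2) ≤
        (haarState n).real
          {ψ : QState n |
            (∀ Λ : Finset (Fin (n + n)),
              infoMeasure Λ (twoCopies ψ) ≤ (2 : ℝ) ^ ((Λ.card : ℝ) - (n : ℝ) / 3)) ∧
            ∀ θ : U.Param,
              ‖U.cost (twoCopies ψ) O θ - trivialValue O‖ ≤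
                K * opNorm O * (2 : ℝ) ^ (-(n : ℝ) / 6)} := by
  obtain ⟨K, hK⟩ := exists_sqrt_card_le D s hD hs
  refine ⟨K, fun n U O _ hO => ?_⟩
  -- Forced by the bound `2^(|Λ| - n/3)`; it leaves `ε² 2^n = 2^(n/3)` in the concentration
  -- exponent.
  set ε : ℝ := (2 : ℝ) ^ (-((n : ℝ) / 3)) with hε
  have hε0 : 0 < ε := by positivity
  have hε1 : ε ≤ 1 := Real.rpow_le_one_of_one_le_of_nonpos one_le_two
    (neg_nonpos.2 (by positivity))
  refine le_trans ?_ ((haarState_real_pauliExpect_le n hε0 hε1).trans (measureReal_mono ?_))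
  · refine sub_le_sub_left ?_ 1
    have h1 : ε ^ 2 * 2 ^ n = (2 : ℝ) ^ ((n : ℝ) / 3) := by
      rw [hε, ← Real.rpow_mul_natCast zero_le_two, ← Real.rpow_natCast, ← Real.rpow_add two_pos]
      congr 1; push_cast; ring
    -- The union bound, `4^n` Pauli operators with two tails each, is exactly the entropy term of
    -- the claim.
    have h2 : (4 : ℝ) ^ n * 2 = Real.exp ((2 * (n : ℝ) + 1) * Real.log 2) := by
      rw [mul_comm _ (Real.log 2), ← Real.rpow_def_of_pos two_pos, Real.rpow_add two_pos,
        Real.rpow_one, Real.rpow_mul zero_le_two, Real.rpow_natCast]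
      norm_num
    rw [← mul_assoc, h2, h1, ← Real.exp_add]
    refine Real.exp_le_exp.2 ?_
    have h3 : (18 * Real.pi ^ 3)⁻¹ * (2 : ℝ) ^ ((n : ℝ) / 3 - 4) ≤ (2 : ℝ) ^ ((n : ℝ) / 3) / 2 := by
      have h4 : (2 : ℝ) ^ ((n : ℝ) / 3 - 4) = (2 : ℝ) ^ ((n : ℝ) / 3) / 16 := by
        rw [Real.rpow_sub two_pos]; norm_num
      have h5 : (18 * Real.pi ^ 3)⁻¹ ≤ 1 := by
        refine inv_le_one_of_one_le₀ ?_
        have : 1 ≤ Real.pi ^ 3 := one_le_pow₀ (by linarith [Real.pi_gt_three])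
        linarith
      have h6 : 0 < (2 : ℝ) ^ ((n : ℝ) / 3) := by positivity
      rw [h4]
      have := mul_le_mul_of_nonneg_right h5 (div_nonneg h6.le (by norm_num : (0 : ℝ) ≤ 16))
      linarith
    linarith
  · intro ψ hψ
    have hP : ∀ P : Fin (n + n) → Pauli, P ≠ (fun _ => Pauli.I) →
        ‖(twoCopies ψ * pauliOp P).trace‖ ≤ ε :=
      fun P hP => norm_trace_twoCopies_mul_pauliOp_le hε1 hψ hP
    refine ⟨fun Λ => ?_, fun θ => ?_⟩
    · refine (infoMeasure_le hε0.le (trace_twoCopies ψ) hP Λ).trans (le_of_eq ?_)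
      rw [hε, ← Real.rpow_natCast, ← Real.rpow_add two_pos, ← sub_eq_add_neg]
    · refine (U.norm_cost_sub_le hε0.le (trace_twoCopies ψ) hP hO θ).trans ?_
      have hO0 : 0 ≤ opNorm O := norm_nonneg _
      calc _ ≤ ε * (K * (2 : ℝ) ^ ((n : ℝ) / 6)) * opNorm O := by
            gcongr
            exact hK n
        _ = K * opNorm O * (ε * (2 : ℝ) ^ ((n : ℝ) / 6)) := by ring
        _ = _ := by
            rw [hε, ← Real.rpow_add two_pos]
            congr 2; ring
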